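/- Let $k\neq l$ be positive integers, at least one of which is odd. Let $\sigma\ne\tau$ be non-zero complex numbers such that both numbers $\tau_1=(2\pi i)^{l-k}\tau$ and $\sigma_1=(-1)^{l-k}(2\pi i)^{l-k}\overline{\sigma}$ are real. Then there is a constant $C$ (depending only on $k,l,\sigma,\tau$) such that for all complex-valued Schwartz functions $f,g$ on $\mathbb{R}^2$ $$\left|\int_{\mathbb{R}^2}\hat f(\xi,\eta)\,\overline{\hat g(\xi,\eta)}\,|\xi|^{k-1}|\eta|^{l-1}\,d\xi\,d\eta\right|\le C\,\big\|(\partial_1^k-\tau\partial_2^l)f\big\|_{L_1(\mathbb{R}^2)}\,\big\|(\partial_1^k-\sigma\partial_2^l)g\big\|_{L_1(\mathbb{R}^2)},$$ where $\hat\varphi(\xi,\eta)=\int_{\mathbb{R}^2}\varphi(x,y)e^{-2\pi i(x\xi+y\eta)}\,dx\,dy$ is the Fourier transform. In other words, the bilinear embedding $\mathrm{BE}(k,l,\tfrac{k-1}{2},\tfrac{l-1}{2},\sigma,\tau)$ holds; here $\mathrm{BE}(k,l,\alpha,\beta,\sigma,\tau)$ denotes the same statement with the weight $|\xi|^{2\alpha}|\eta|^{2\beta}$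 on the left-hand side. -/

import Mathlib

open scoped SchwartzMap FourierTransform LineDeriv ComplexConjugate

noncomputable section

namespace BilinearEmbedding

/-- The plane `ℝ²` with its Euclidean structure and Lebesgue measure. -/
abbrev Plane : Type := EuclideanSpace ℝ (Fin 2)

/-- The partial derivative `∂ⱼ` of a Schwartz function on the plane (`j = 0` is the first variable,
`j = 1` is the second). -/
def partialD (j : Fin 2) (f : 𝓢(Plane, ℂ)) : 𝓢(Plane, ℂ) :=
  ∂_{(EuclideanSpace.single j (1 : ℝ) : Plane)} f

/-- The differential operator `∂₁ᵏ - τ ∂₂ˡ` on Schwartz functions. -/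
def diffOp (k l : ℕ) (τ : ℂ) (f : 𝓢(Plane, ℂ)) : 𝓢(Plane, ℂ) :=
  (partialD 0)^[k] f - τ • (partialD 1)^[l] f

/-- The `L₁` norm of a Schwartz function on the plane. -/
def normL1 (f : 𝓢(Plane, ℂ)) : ℝ := ∫ x : Plane, ‖f x‖

/-- The scalar product of the fractional anisotropic Sobolev space `W₂^{α,β}(ℝ²)`; the Fourier
transform is `𝓕 f p = ∫ f x * exp (-2 π i ⟨x, p⟩)`. -/
def sobolevInner (α β : ℝ) (f g : 𝓢(Plane, ℂ)) : ℂ :=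
  ∫ p : Plane, 𝓕 f p * conj (𝓕 g p) * ((|p 0| ^ (2 * α) * |p 1| ^ (2 * β) : ℝ) : ℂ)

/-- The bilinear embedding statement `BE(k, l, α, β, σ, τ)`. -/
def BE (k l : ℕ) (α β : ℝ) (σ τ : ℂ) : Prop :=
  ∃ C : ℝ, ∀ f g : 𝓢(Plane, ℂ),
    ‖sobolevInner α β f g‖ ≤ C * normL1 (diffOp k l τ f) * normL1 (diffOp k l σ g)

/-- The number `τ₁ = (2 π i)^(l-k) τ`. -/
def tauOne (k l : ℕ) (τ : ℂ) : ℂ :=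
  (2 * (Real.pi : ℂ) * Complex.I) ^ ((l : ℤ) - (k : ℤ)) * τ

/-- The number `σ₁ = (-1)^(l-k) (2 π i)^(l-k) conj σ`. -/
def sigmaOne (k l : ℕ) (σ : ℂ) : ℂ :=
  (-1 : ℂ) ^ ((l : ℤ) - (k : ℤ)) * (2 * (Real.pi : ℂ) * Complex.I) ^ ((l : ℤ) - (k : ℤ)) * conj σ

end BilinearEmbedding

end

/-! Put F = (∂₁ᵏ - τ∂₂ˡ)f and G = (∂₁ᵏ - σ∂₂ˡ)g. Since a = τ₁ and b = σ₁ are real, F̂ times the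
conjugate of Ĝ equals, up to a positive constant, (ξᵏ - aηˡ)(ξᵏ - bηˡ) times f̂ · conj ĝ. The
left-hand side is therefore a bilinear form in F and G with multiplier m = |ξ|^(k-1)|η|^(l-1) / ((ξᵏ
- aηˡ)(ξᵏ - bηˡ)). A multiplier with bounded Fourier transform is bounded on L₁ × L₁
(`norm_integral_mul_fourier_le`), so the task is to bound the Fourier transform of regularizations
of m uniformly.

Let k be odd, so that |ξ|^(k-1) = ξ^(k-1) and aηˡ = Aᵏ, bηˡ = Bᵏ have real solutions A, B of size
|η|^p with p = l/k. Partial fractions and the logarithmic derivative of ξᵏ - Aᵏ (`sum_inv_sub_rho`)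
write k(a - b)m as |η|^(l-1)/ηˡ = ±1/η times a sum of differences of 1/(ξ - root of Aᵏ) and 1/(ξ -
root of Bᵏ), the roots being paired in the same closed half-plane. The Fourier transform in ξ turns
each difference into exp(Ω₁|η|^p) - exp(Ω₂|η|^p) with Re Ωᵢ ≤ 0 and |Ω₁| comparable to |Ω₂|. What
remains is an oscillatory integral against du/u, bounded in `exists_norm_integral_exp_phase_sub_le`:
near 0 the two exponentials cancel, far from 0 each integral converges by a first-derivative test,
and around the stationary point u stays in a dyadic block of bounded du/u-measure. The stationary
point is isolated because p ≠ 1, that is, k ≠ l.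

To make everything integrable, η is restricted to an annulus and the roots are moved off the real
axis (`exists_norm_fourier_kernel_le` is uniform in both). The regularizations are removed by
dominated convergence, the factors ξᵏ - aηˡ and ξᵏ - bηˡ compensating the singularities. If only l
is odd, the coordinates are exchanged and a, b replaced by their inverses. -/

namespace BilinearEmbedding

open MeasureTheory Complex Set Filter Topology

/-! ### Oscillatory integrals with the measure `du / u` -/

lemma norm_exp_le_one_of_re_nonpos {z : ℂ} (hz : z.re ≤ 0) : ‖exp z‖ ≤ 1 := by
  rw [norm_exp]; exact Real.exp_le_one_iff.2 hz

lemma norm_exp_sub_exp_le {z w : ℂ} (hz : z.re ≤ 0) (hw : w.re ≤ 0) :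
    ‖exp z - exp w‖ ≤ ‖z - w‖ := by
  have := Convex.norm_image_sub_le_of_norm_hasDerivWithin_le (𝕜 := ℂ) (f := exp) (f' := exp)
    (s := {z : ℂ | z.re ≤ 0}) (C := 1) (x := w) (y := z)
    (fun x _ => (hasDerivAt_exp x).hasDerivWithinAt)
    (fun x hx => norm_exp_le_one_of_re_nonpos hx) (convex_halfSpace_re_le 0) hw hz
  simpa using this

/-- The phase `i y u + Ω u ^ p`. -/
noncomputable def phase (p y : ℝ) (Ω : ℂ) (u : ℝ) : ℂ := I * (y : ℂ) * (u : ℂ) + Ω * ((u ^ p : ℝ) : ℂ)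

/-- The derivative of `phase`. -/
noncomputable def phaseD (p y : ℝ) (Ω : ℂ) (u : ℝ) : ℂ := I * (y : ℂ) + Ω * ((p * u ^ (p - 1) : ℝ) : ℂ)

lemma phase_re_nonpos {p y : ℝ} {Ω : ℂ} (hΩ : Ω.re ≤ 0) {u : ℝ} (hu : 0 < u) :
    (phase p y Ω u).re ≤ 0 := by
  have : 0 ≤ u ^ p := by positivity
  simp only [phase, add_re, mul_re, I_re, I_im, ofReal_re, ofReal_im, mul_im]
  nlinarith

lemma hasDerivAt_phase (p y : ℝ) (Ω : ℂ) {u : ℝ} (hu : 0 < u) :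
    HasDerivAt (phase p y Ω) (phaseD p y Ω u) u := by
  have h1 : HasDerivAt (fun u : ℝ => (u : ℂ)) 1 u := ofRealCLM.hasDerivAt
  have h2 : HasDerivAt (fun u : ℝ => ((u ^ p : ℝ) : ℂ)) ((p * u ^ (p - 1) : ℝ) : ℂ) u :=
    (Real.hasDerivAt_rpow_const (Or.inl hu.ne')).ofReal_comp
  have := (h1.const_mul (I * (y : ℂ))).add (h2.const_mul Ω)
  rw [mul_one] at this
  exact this

/-- The second derivative of `phase`. -/
noncomputable def phaseDD (p : ℝ) (Ω : ℂ) (u : ℝ) : ℂ := Ω * ((p * ((p - 1) * u ^ (p - 1 - 1)) : ℝ) : ℂ)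

lemma hasDerivAt_phaseD (p y : ℝ) (Ω : ℂ) {u : ℝ} (hu : 0 < u) :
    HasDerivAt (phaseD p y Ω) (phaseDD p Ω u) u := by
  have h2 : HasDerivAt (fun u : ℝ => ((p * u ^ (p - 1) : ℝ) : ℂ))
      ((p * ((p - 1) * u ^ (p - 1 - 1)) : ℝ) : ℂ) u :=
    ((Real.hasDerivAt_rpow_const (Or.inl hu.ne')).const_mul p).ofReal_comp
  exact (h2.const_mul Ω).const_add (I * (y : ℂ))

lemma continuousOn_phaseDD (p : ℝ) (Ω : ℂ) : ContinuousOn (phaseDD p Ω) (Ioi 0) := by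
  unfold phaseDD
  refine continuousOn_const.mul (continuous_ofReal.comp_continuousOn ?_)
  exact continuousOn_const.mul (continuousOn_const.mul
    (continuousOn_id.rpow_const fun x hx => Or.inl (ne_of_gt hx)))

lemma continuousOn_phase (p y : ℝ) (Ω : ℂ) : ContinuousOn (phase p y Ω) (Ioi 0) :=
  fun _ hu => (hasDerivAt_phase p y Ω hu).continuousAt.continuousWithinAt

lemma continuousOn_phaseD (p y : ℝ) (Ω : ℂ) : ContinuousOn (phaseD p y Ω) (Ioi 0) :=
  fun _ hu => (hasDerivAt_phaseD p y Ω hu).continuousAt.continuousWithinAt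

lemma continuousOn_inv_ofReal : ContinuousOn (fun u : ℝ => ((u : ℂ))⁻¹) (Ioi 0) :=
  continuous_ofReal.continuousOn.inv₀ fun x hx => by
    simpa using (ne_of_gt hx : x ≠ 0)

lemma continuousOn_exp_phase_div (p y : ℝ) (Ω : ℂ) :
    ContinuousOn (fun u : ℝ => exp (phase p y Ω u) * ((u : ℂ))⁻¹) (Ioi 0) :=
  (continuousOn_phase p y Ω).cexp.mul continuousOn_inv_ofReal

lemma uIcc_subset_Ioi {A B : ℝ} (hA : 0 < A) (hAB : A ≤ B) : uIcc A B ⊆ Ioi 0 := by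
  rw [uIcc_of_le hAB]; exact fun x hx => lt_of_lt_of_le hA hx.1

lemma intervalIntegrable_exp_phase_div (p y : ℝ) (Ω : ℂ) {A B : ℝ} (hA : 0 < A) (hAB : A ≤ B) :
    IntervalIntegrable (fun u : ℝ => exp (phase p y Ω u) * ((u : ℂ))⁻¹) volume A B :=
  ((continuousOn_exp_phase_div p y Ω).mono (uIcc_subset_Ioi hA hAB)).intervalIntegrable

lemma integral_rpow_neg_le {p A B : ℝ} (hp : 0 < p) (hA : 0 < A) (hAB : A ≤ B) :
    ∫ u in A..B, u ^ (-p - 1) ≤ A ^ (-p) / p := by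
  rw [integral_rpow (Or.inr ⟨by linarith, fun h => absurd (uIcc_subset_Ioi hA hAB h) (by simp)⟩)]
  have hB : 0 ≤ B ^ (-p) := Real.rpow_nonneg (hA.le.trans hAB) _
  rw [show -p - 1 + 1 = -p by ring, div_neg, neg_div', neg_sub]
  gcongr
  linarith

/-- First-derivative test: off the stationary point the integral is bounded. -/
lemma norm_integral_exp_phase_le_of_phaseD {p c : ℝ} (hp : 0 < p) (hc : 0 < c) {y : ℝ} {Ω : ℂ}
    (hΩ : Ω ≠ 0) (hre : Ω.re ≤ 0) {A B : ℝ} (hA : 0 < A) (hAB : A ≤ B) (h1 : 1 ≤ A ^ p * ‖Ω‖)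
    (hd : ∀ u ∈ Icc A B, c * ‖Ω‖ * u ^ (p - 1) ≤ ‖phaseD p y Ω u‖) :
    ‖∫ u in A..B, exp (phase p y Ω u) * ((u : ℂ))⁻¹‖
      ≤ 2 / c + (1 / c + p * |p - 1| / c ^ 2) / p := by
  set d := phaseD p y Ω
  -- Integration by parts: exp(phase)/u is (exp(phase))' times `h`, leaving two boundary terms and
  -- an integral of exp(phase) · `h'`.
  set h : ℝ → ℂ := fun u => ((u : ℂ) * d u)⁻¹ with hh
  set h' : ℝ → ℂ := fun u => -(1 * d u + (u : ℂ) * phaseDD p Ω u) / ((u : ℂ) * d u) ^ 2 with hh'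
  have hΩ0 : 0 < ‖Ω‖ := norm_pos_iff.2 hΩ
  have hpos : ∀ u ∈ Icc A B, 0 < u := fun u hu => lt_of_lt_of_le hA hu.1
  have hdpos : ∀ u ∈ Icc A B, 0 < ‖d u‖ := fun u hu =>
    lt_of_lt_of_le (by have := hpos u hu; positivity) (hd u hu)
  have hne : ∀ u ∈ Icc A B, (u : ℂ) * d u ≠ 0 := fun u hu =>
    mul_ne_zero (by exact_mod_cast (hpos u hu).ne') (norm_pos_iff.1 (hdpos u hu))
  have hderiv : ∀ u ∈ Icc A B, HasDerivAt h (h' u) u := fun u hu =>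
    ((ofRealCLM.hasDerivAt (x := u)).mul (hasDerivAt_phaseD p y Ω (hpos u hu))).inv (hne u hu)
  have hderiv2 : ∀ u ∈ uIcc A B, HasDerivAt (fun u => exp (phase p y Ω u) * h u)
      (exp (phase p y Ω u) * ((u : ℂ))⁻¹ + exp (phase p y Ω u) * h' u) u := by
    intro u hu
    rw [uIcc_of_le hAB] at hu
    have := (hasDerivAt_phase p y Ω (hpos u hu)).cexp.mul (hderiv u hu)
    refine this.congr_deriv ?_
    have h3 := norm_pos_iff.1 (hdpos u hu)
    have h4 : (u : ℂ) ≠ 0 := by exact_mod_cast (hpos u hu).ne'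
    change exp (phase p y Ω u) * d u * ((u : ℂ) * d u)⁻¹ + _ = _
    field_simp
  have hsub : Icc A B ⊆ Ioi 0 := fun u hu => hpos u hu
  have hcont' : ContinuousOn (fun u => exp (phase p y Ω u) * h' u) (Icc A B) := by
    refine ((continuousOn_phase p y Ω).mono hsub).cexp.mul (ContinuousOn.div ?_ ?_ ?_)
    · exact ((continuousOn_const.mul ((continuousOn_phaseD p y Ω).mono hsub)).add
        (continuous_ofReal.continuousOn.mul ((continuousOn_phaseDD p Ω).mono hsub))).neg
    · exact (continuous_ofReal.continuousOn.mul ((continuousOn_phaseD p y Ω).mono hsub)).pow 2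
    · exact fun u hu => pow_ne_zero 2 (hne u hu)
  have hint' : IntervalIntegrable (fun u => exp (phase p y Ω u) * h' u) volume A B := by
    rw [← uIcc_of_le hAB] at hcont'; exact hcont'.intervalIntegrable
  have hint := intervalIntegrable_exp_phase_div p y Ω hA hAB
  have key := intervalIntegral.integral_eq_sub_of_hasDerivAt hderiv2 (hint.add hint')
  rw [intervalIntegral.integral_add hint hint'] at key
  have hexp : ∀ u ∈ Icc A B, ‖exp (phase p y Ω u)‖ ≤ 1 := fun u hu =>
    norm_exp_le_one_of_re_nonpos (phase_re_nonpos hre (hpos u hu))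
  have hinv : ∀ u ∈ Icc A B, ‖d u‖⁻¹ ≤ u ^ (1 - p) / (c * ‖Ω‖) := by
    intro u hu
    have hu0 := hpos u hu
    rw [show (1 - p) = -(p - 1) by ring, Real.rpow_neg hu0.le, div_eq_mul_inv, mul_comm,
      ← mul_inv]
    exact inv_anti₀ (by positivity) (hd u hu)
  have hbd : ∀ u ∈ Icc A B, ‖h u‖ ≤ u ^ (-p) / (c * ‖Ω‖) := by
    intro u hu
    have hu0 := hpos u hu
    simp only [hh, norm_inv, norm_mul, mul_inv, norm_real, Real.norm_of_nonneg hu0.le]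
    calc u⁻¹ * ‖d u‖⁻¹ ≤ u⁻¹ * (u ^ (1 - p) / (c * ‖Ω‖)) := by
          gcongr; exact hinv u hu
      _ = u ^ (-p) / (c * ‖Ω‖) := by
          rw [← mul_div_assoc, ← Real.rpow_neg_one u, ← Real.rpow_add hu0]; ring_nf
  -- The condition 1 ≤ A^p‖Ω‖ is what removes Ω from the bound, here for the boundary terms and
  -- again in `hI` for the integral.
  have hbd1 : ∀ u ∈ Icc A B, ‖h u‖ ≤ 1 / c := by
    intro u hu
    have hu0 := hpos u hu
    refine (hbd u hu).trans ?_
    rw [Real.rpow_neg hu0.le, div_le_div_iff₀ (by positivity) hc, one_mul]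
    have : (u ^ p)⁻¹ ≤ ‖Ω‖ := by
      rw [inv_le_iff_one_le_mul₀ (by positivity)]
      refine h1.trans ?_
      rw [mul_comm]
      gcongr
      exact hu.1
    nlinarith
  have hbd' : ∀ u ∈ Icc A B, ‖exp (phase p y Ω u) * h' u‖
      ≤ (1 / c + p * |p - 1| / c ^ 2) / ‖Ω‖ * u ^ (-p - 1) := by
    intro u hu
    have hu0 := hpos u hu
    have e1 : h' u = -((d u)⁻¹ * ((u : ℂ))⁻¹ ^ 2 + phaseDD p Ω u * ((u : ℂ))⁻¹ * (d u)⁻¹ ^ 2) := by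
      have h3 := norm_pos_iff.1 (hdpos u hu)
      have h4 : (u : ℂ) ≠ 0 := by exact_mod_cast hu0.ne'
      simp only [hh']
      field_simp
    have e2 : ‖phaseDD p Ω u‖ = ‖Ω‖ * (p * |p - 1| * u ^ (p - 2)) := by
      rw [phaseDD, norm_mul, norm_real, Real.norm_eq_abs, abs_mul, abs_mul, abs_of_pos hp,
        abs_of_nonneg (Real.rpow_nonneg hu0.le _)]
      ring_nf
    calc ‖exp (phase p y Ω u) * h' u‖ ≤ 1 * ‖h' u‖ := by
          rw [norm_mul]; gcongr; exact hexp u hu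
      _ ≤ ‖d u‖⁻¹ * u⁻¹ ^ 2 + ‖phaseDD p Ω u‖ * u⁻¹ * ‖d u‖⁻¹ ^ 2 := by
          rw [one_mul, e1, norm_neg]
          refine (norm_add_le _ _).trans_eq ?_
          simp [abs_of_pos hu0]
      _ ≤ (u ^ (1 - p) / (c * ‖Ω‖)) * u⁻¹ ^ 2
          + ‖phaseDD p Ω u‖ * u⁻¹ * (u ^ (1 - p) / (c * ‖Ω‖)) ^ 2 := by
          gcongr <;> exact hinv u hu
      _ = (1 / c + p * |p - 1| / c ^ 2) / ‖Ω‖ * u ^ (-p - 1) := by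
          rw [e2]
          have f1 : u ^ (1 - p) * u⁻¹ ^ 2 = u ^ (-p - 1) := by
            rw [← Real.rpow_neg_one u, ← Real.rpow_natCast, ← Real.rpow_mul hu0.le,
              ← Real.rpow_add hu0]
            norm_num; ring_nf
          have f2 : u ^ (p - 2) * u⁻¹ * (u ^ (1 - p)) ^ 2 = u ^ (-p - 1) := by
            rw [← Real.rpow_neg_one u, ← Real.rpow_natCast, ← Real.rpow_mul hu0.le,
              ← Real.rpow_add hu0, ← Real.rpow_add hu0]
            norm_num; ring_nf
          calc _ = (1 / (c * ‖Ω‖)) * (u ^ (1 - p) * u⁻¹ ^ 2)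
                + ‖Ω‖ * (p * |p - 1|) / (c * ‖Ω‖) ^ 2
                  * (u ^ (p - 2) * u⁻¹ * (u ^ (1 - p)) ^ 2) := by ring
            _ = _ := by rw [f1, f2]; field_simp
  have hD : 0 ≤ 1 / c + p * |p - 1| / c ^ 2 := by positivity
  have hI : ‖∫ u in A..B, exp (phase p y Ω u) * h' u‖
      ≤ (1 / c + p * |p - 1| / c ^ 2) / p := by
    have hii : IntervalIntegrable
        (fun u : ℝ => (1 / c + p * |p - 1| / c ^ 2) / ‖Ω‖ * u ^ (-p - 1)) volume A B := by
      refine (ContinuousOn.intervalIntegrable ?_)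
      exact continuousOn_const.mul (continuousOn_id.rpow_const
        fun x hx => Or.inl (ne_of_gt (uIcc_subset_Ioi hA hAB hx)))
    refine (intervalIntegral.norm_integral_le_of_norm_le hAB
      (Eventually.of_forall fun u hu => hbd' u (Ioc_subset_Icc_self hu)) hii).trans ?_
    rw [intervalIntegral.integral_const_mul]
    calc _ ≤ (1 / c + p * |p - 1| / c ^ 2) / ‖Ω‖ * (A ^ (-p) / p) := by
          gcongr; exact integral_rpow_neg_le hp hA hAB
      _ = (1 / c + p * |p - 1| / c ^ 2) / p * (A ^ p * ‖Ω‖)⁻¹ := by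
          rw [Real.rpow_neg hA.le]; field_simp
      _ ≤ (1 / c + p * |p - 1| / c ^ 2) / p * 1 := by
          gcongr; exact inv_le_one_of_one_le₀ h1
      _ = _ := mul_one _
  have hend : ∀ u ∈ Icc A B, ‖exp (phase p y Ω u) * h u‖ ≤ 1 / c := fun u hu => by
    rw [norm_mul]
    calc _ ≤ 1 * (1 / c) := by gcongr; exacts [hexp u hu, hbd1 u hu]
      _ = _ := one_mul _
  rw [eq_sub_of_add_eq key]
  calc _ ≤ ‖exp (phase p y Ω B) * h B‖ + ‖exp (phase p y Ω A) * h A‖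
        + ‖∫ u in A..B, exp (phase p y Ω u) * h' u‖ :=
        (norm_sub_le _ _).trans (add_le_add_left (norm_sub_le _ _) _)
    _ ≤ 1 / c + 1 / c + (1 / c + p * |p - 1| / c ^ 2) / p := by
        gcongr
        exacts [hend B ⟨hAB, le_rfl⟩, hend A ⟨le_rfl, hAB⟩]
    _ = _ := by ring

/-- By the reverse triangle inequality only ‖Ω‖ matters, so a complex Ω is treated like the real
oscillatory case with its single critical scale. -/
lemma norm_phaseD_ge {p y : ℝ} (hp : 0 < p) (Ω : ℂ) {u : ℝ} (hu : 0 < u) :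
    |(|y| - p * ‖Ω‖ * u ^ (p - 1))| ≤ ‖phaseD p y Ω u‖ := by
  have := abs_norm_sub_norm_le (I * (y : ℂ)) (-(Ω * ((p * u ^ (p - 1) : ℝ) : ℂ)))
  rw [sub_neg_eq_add] at this
  refine le_of_eq_of_le ?_ this
  simp only [norm_neg, norm_mul, norm_I, norm_real, one_mul, Real.norm_eq_abs]
  rw [abs_of_pos hp, abs_of_pos (Real.rpow_pos_of_pos hu _)]
  ring_nf

/-- A lower bound for `|s ^ q - 1|` when `s ≥ 2` or `s ≤ 1 / 2`. -/
lemma exists_abs_rpow_sub_one_ge {q : ℝ} (hq : q ≠ 0) :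
    ∃ c > 0, ∀ s : ℝ, 0 < s → (2 ≤ s ∨ s ≤ 1 / 2) → c ≤ |s ^ q - 1| := by
  have key : ∀ r : ℝ, 0 < r → ∃ c > 0, ∀ s : ℝ, 0 < s → (2 ≤ s ∨ s ≤ 1 / 2) →
      c ≤ |s ^ r - 1| := by
    intro r hr
    have h2 : (1 : ℝ) < 2 ^ r := Real.one_lt_rpow (by norm_num) hr
    have h3 : ((1 : ℝ) / 2) ^ r < 1 := Real.rpow_lt_one (by norm_num) (by norm_num) hr
    refine ⟨min (2 ^ r - 1) (1 - (1 / 2) ^ r), lt_min (by linarith) (by linarith), ?_⟩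
    rintro s hs (h | h)
    · refine (min_le_left _ _).trans ((?_ : _ ≤ s ^ r - 1).trans (le_abs_self _))
      gcongr
    · refine (min_le_right _ _).trans ((?_ : _ ≤ -(s ^ r - 1)).trans (neg_le_abs _))
      have : s ^ r ≤ (1 / 2) ^ r := by gcongr
      linarith
  rcases lt_or_gt_of_ne hq with h | h
  · obtain ⟨c, hc, H⟩ := key (-q) (by linarith)
    refine ⟨c, hc, fun s hs hh => ?_⟩
    have := H s⁻¹ (inv_pos.2 hs) (hh.symm.imp (fun h' => ?_) fun h' => ?_)
    · rwa [Real.inv_rpow hs.le, ← Real.rpow_neg hs.le, neg_neg] at this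
    · rw [le_inv_comm₀ (by norm_num) hs]; linarith
    · rw [inv_le_comm₀ hs (by norm_num)]; linarith
  · exact key q h

/-- No oscillation is needed on an interval of bounded ratio: the integrand is at most 1/A and the
length at most 3A. This absorbs the stationary point. -/
lemma norm_integral_exp_phase_le_of_ratio {p y : ℝ} {Ω : ℂ} (hre : Ω.re ≤ 0) {A B : ℝ}
    (hA : 0 < A) (hAB : A ≤ B) (h4 : B ≤ 4 * A) :
    ‖∫ u in A..B, exp (phase p y Ω u) * ((u : ℂ))⁻¹‖ ≤ 3 := by
  have : ∀ u ∈ uIoc A B, ‖exp (phase p y Ω u) * ((u : ℂ))⁻¹‖ ≤ A⁻¹ := by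
    intro u hu
    rw [uIoc_of_le hAB] at hu
    have hu0 : 0 < u := hA.trans hu.1
    rw [norm_mul, norm_inv, norm_real, Real.norm_of_nonneg hu0.le]
    calc _ ≤ 1 * A⁻¹ := by
          gcongr
          exacts [norm_exp_le_one_of_re_nonpos (phase_re_nonpos hre hu0), hu.1.le]
      _ = _ := one_mul _
  refine (intervalIntegral.norm_integral_le_of_norm_le_const this).trans ?_
  rw [abs_of_nonneg (by linarith), inv_mul_le_iff₀ hA]
  linarith

lemma exists_norm_integral_exp_phase_le {p : ℝ} (hp : 0 < p) (hp1 : p ≠ 1) :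
    ∃ C : ℝ, 0 ≤ C ∧ ∀ (y : ℝ) (Ω : ℂ), Ω ≠ 0 → Ω.re ≤ 0 → ∀ A B : ℝ, 0 < A → A ≤ B →
      1 ≤ A ^ p * ‖Ω‖ → ‖∫ u in A..B, exp (phase p y Ω u) * ((u : ℂ))⁻¹‖ ≤ C := by
  obtain ⟨c₀, hc₀, Hc⟩ := exists_abs_rpow_sub_one_ge (sub_ne_zero.2 hp1)
  -- The `1` in the minimum serves the case y = 0, where the derivative has norm at least
  -- p‖Ω‖u^(p-1).
  set c : ℝ := p * min c₀ 1
  have hc : 0 < c := mul_pos hp (lt_min hc₀ one_pos)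
  set D : ℝ := 2 / c + (1 / c + p * |p - 1| / c ^ 2) / p
  have hD : 0 ≤ D := by positivity
  refine ⟨D + 3 + D, by positivity, fun y Ω hΩ hre A B hA hAB h1 => ?_⟩
  have hΩ0 : 0 < ‖Ω‖ := norm_pos_iff.2 hΩ
  by_cases hy : y = 0
  · refine (norm_integral_exp_phase_le_of_phaseD hp hc hΩ hre hA hAB h1 fun u hu => ?_).trans
      (by linarith : D ≤ _)
    have hu0 : 0 < u := hA.trans_le hu.1
    refine le_trans ?_ (norm_phaseD_ge hp Ω hu0)
    rw [hy, abs_zero, zero_sub, abs_neg, abs_of_pos (by positivity)]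
    have : c ≤ p := mul_le_of_le_one_right hp.le (min_le_right _ _)
    gcongr
  set t : ℝ := |y| / (p * ‖Ω‖) with ht
  have ht0 : 0 < t := by positivity
  -- The critical scale, where |y| = p‖Ω‖u^(p-1). Its existence and uniqueness rest on p ≠ 1.
  set e : ℝ := t ^ (p - 1)⁻¹ with he
  have he0 : 0 < e := by positivity
  have het : e ^ (p - 1) = t := by
    rw [he, ← Real.rpow_mul ht0.le, inv_mul_cancel₀ (sub_ne_zero.2 hp1), Real.rpow_one]
  have hyt : |y| = p * ‖Ω‖ * e ^ (p - 1) := by rw [het, ht]; field_simp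
  have good : ∀ u : ℝ, 0 < u → (u ≤ e / 2 ∨ 2 * e ≤ u) →
      c * ‖Ω‖ * u ^ (p - 1) ≤ ‖phaseD p y Ω u‖ := by
    intro u hu0 hu
    refine le_trans ?_ (norm_phaseD_ge hp Ω hu0)
    have h5 : c₀ ≤ |(e / u) ^ (p - 1) - 1| := by
      refine Hc _ (by positivity) (hu.imp (fun h => ?_) fun h => ?_)
      · rw [le_div_iff₀ hu0]; linarith
      · rw [div_le_iff₀ hu0]; linarith
    have h6 : |y| - p * ‖Ω‖ * u ^ (p - 1)
        = p * ‖Ω‖ * u ^ (p - 1) * ((e / u) ^ (p - 1) - 1) := by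
      rw [hyt, Real.div_rpow he0.le hu0.le]
      have : u ^ (p - 1) ≠ 0 := (Real.rpow_pos_of_pos hu0 _).ne'
      field_simp
    rw [h6, abs_mul, abs_of_pos (by positivity)]
    have h7 : c ≤ p * |(e / u) ^ (p - 1) - 1| := by
      have := min_le_left c₀ 1
      simp only [c]; gcongr; exact this.trans h5
    calc c * ‖Ω‖ * u ^ (p - 1) ≤ (p * |(e / u) ^ (p - 1) - 1|) * ‖Ω‖ * u ^ (p - 1) := by gcongr
      _ = _ := by ring
  -- `P` and `Q` are e/2 and 2e clamped to [A, B]. The derivative test applies outside [P, Q], and Q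
  -- ≤ 4P.
  set P := max A (min B (e / 2))
  set Q := max A (min B (2 * e))
  have hAP : A ≤ P := le_max_left _ _
  have hPQ : P ≤ Q := max_le_max le_rfl (min_le_min le_rfl (by linarith))
  have hQB : Q ≤ B := max_le hAB (min_le_left _ _)
  have hP0 : 0 < P := hA.trans_le hAP
  have hQ0 : 0 < Q := hP0.trans_le hPQ
  have hB0 : 0 < B := hA.trans_le hAB
  have hQP : Q ≤ 4 * P := by
    refine max_le (by linarith) ?_
    rcases le_total B (e / 2) with h | h
    · have : B ≤ P := (le_min le_rfl h).trans (le_max_right _ _)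
      linarith [min_le_left B (2 * e)]
    · have : e / 2 ≤ P := (le_min h le_rfl).trans (le_max_right _ _)
      linarith [min_le_right B (2 * e)]
  have hI := fun {A B : ℝ} => intervalIntegrable_exp_phase_div p y Ω (A := A) (B := B)
  rw [← intervalIntegral.integral_add_adjacent_intervals (hI hA (hAP.trans hPQ)) (hI hQ0 hQB),
    ← intervalIntegral.integral_add_adjacent_intervals (hI hA hAP) (hI hP0 hPQ)]
  refine (norm_add_le _ _).trans (add_le_add ((norm_add_le _ _).trans (add_le_add ?_ ?_)) ?_)
  · rcases le_total (e / 2) A with h | h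
    · have : P = A := max_eq_left ((min_le_right _ _).trans h)
      rw [this, intervalIntegral.integral_same, norm_zero]; exact hD
    · refine norm_integral_exp_phase_le_of_phaseD hp hc hΩ hre hA hAP h1 fun u hu => ?_
      refine good u (hA.trans_le hu.1) (Or.inl (hu.2.trans (max_le h (min_le_right _ _))))
  · exact norm_integral_exp_phase_le_of_ratio hre hP0 hPQ hQP
  · rcases le_total B (2 * e) with h | h
    · have : Q = B := by simp only [Q]; rw [min_eq_left h, max_eq_right hAB]
      rw [this, intervalIntegral.integral_same, norm_zero]; exact hD
    · refine norm_integral_exp_phase_le_of_phaseD hp hc hΩ hre hQ0 hQB ?_ fun u hu => ?_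
      · refine h1.trans ?_
        gcongr
        exact hAP.trans hPQ
      · refine good u (hQ0.trans_le hu.1) (Or.inr (le_trans ?_ hu.1))
        exact (le_min h le_rfl).trans (le_max_right _ _)

/-- The linear terms of the two phases agree and exp is 1-Lipschitz on the left half-plane, so the
difference is O(u^p), which makes du/u integrable at 0. -/
lemma norm_integral_exp_phase_sub_le {p y : ℝ} (hp : 0 < p) {Ω₁ Ω₂ : ℂ} (hre₁ : Ω₁.re ≤ 0)
    (hre₂ : Ω₂.re ≤ 0) {A B : ℝ} (hA : 0 < A) (hAB : A ≤ B) :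
    ‖∫ u in A..B, (exp (phase p y Ω₁ u) * ((u : ℂ))⁻¹ - exp (phase p y Ω₂ u) * ((u : ℂ))⁻¹)‖
      ≤ B ^ p * (‖Ω₁‖ + ‖Ω₂‖) / p := by
  have hb : ∀ u ∈ Ioc A B, ‖exp (phase p y Ω₁ u) * ((u : ℂ))⁻¹
      - exp (phase p y Ω₂ u) * ((u : ℂ))⁻¹‖ ≤ (‖Ω₁‖ + ‖Ω₂‖) * u ^ (p - 1) := by
    intro u hu
    have hu0 : 0 < u := hA.trans hu.1
    rw [← sub_mul, norm_mul, norm_inv, norm_real, Real.norm_of_nonneg hu0.le]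
    have h1 := norm_exp_sub_exp_le (phase_re_nonpos (p := p) (y := y) hre₁ hu0)
      (phase_re_nonpos (p := p) (y := y) hre₂ hu0)
    have h2 : phase p y Ω₁ u - phase p y Ω₂ u = (Ω₁ - Ω₂) * ((u ^ p : ℝ) : ℂ) := by
      simp only [phase]; ring
    rw [h2, norm_mul, norm_real, Real.norm_of_nonneg (by positivity)] at h1
    calc _ ≤ (‖Ω₁‖ + ‖Ω₂‖) * u ^ p * u⁻¹ := by
          gcongr
          exact h1.trans (by gcongr; exact norm_sub_le _ _)
      _ = _ := by rw [Real.rpow_sub_one hu0.ne']; ring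
  have hii : IntervalIntegrable (fun u : ℝ => (‖Ω₁‖ + ‖Ω₂‖) * u ^ (p - 1)) volume A B :=
    (intervalIntegral.intervalIntegrable_rpow' (by linarith)).const_mul _
  refine (intervalIntegral.norm_integral_le_of_norm_le hAB (Eventually.of_forall hb) hii).trans ?_
  rw [intervalIntegral.integral_const_mul, integral_rpow (Or.inl (by linarith)), sub_add_cancel,
    ← mul_div_assoc, mul_comm]
  have : 0 ≤ A ^ p := by positivity
  gcongr
  linarith

/-- Uniform bound for the Fourier transform of the difference of two kernels `exp (Ω u ^ p) / u`
truncated to `[δ, R]`. -/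
theorem exists_norm_integral_exp_phase_sub_le {p : ℝ} (hp : 0 < p) (hp1 : p ≠ 1) (K : ℝ) :
    ∃ C : ℝ, 0 ≤ C ∧ ∀ (y : ℝ) (Ω₁ Ω₂ : ℂ), Ω₁.re ≤ 0 → Ω₂.re ≤ 0 → ‖Ω₁‖ ≤ K * ‖Ω₂‖ →
      ‖Ω₂‖ ≤ K * ‖Ω₁‖ → ∀ A B : ℝ, 0 < A → A ≤ B →
      ‖∫ u in A..B, (exp (phase p y Ω₁ u) * ((u : ℂ))⁻¹
        - exp (phase p y Ω₂ u) * ((u : ℂ))⁻¹)‖ ≤ C := by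
  obtain ⟨C, hC0, hC⟩ := exists_norm_integral_exp_phase_le hp hp1
  refine ⟨(2 + |K| + |K|) / p + (C + C), by positivity,
    fun y Ω₁ Ω₂ hre₁ hre₂ hK₁ hK₂ A B hA hAB => ?_⟩
  by_cases h0 : Ω₁ = 0 ∨ Ω₂ = 0
  · have h1 : Ω₁ = 0 := by
      rcases h0 with h | h
      · exact h
      · simpa [h] using hK₁
    have h2 : Ω₂ = 0 := by simpa [h1] using hK₂
    simp only [h1, h2, sub_self, intervalIntegral.integral_zero, norm_zero]
    positivity
  push Not at h0
  have n1 : 0 < ‖Ω₁‖ := norm_pos_iff.2 h0.1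
  have n2 : 0 < ‖Ω₂‖ := norm_pos_iff.2 h0.2
  -- The splitting point: beyond `M` both u^p‖Ωᵢ‖ are at least 1, while M^p(‖Ω₁‖ + ‖Ω₂‖) is 2 plus
  -- the two ratios, hence at most 2 + 2|K|.
  set M : ℝ := (1 / ‖Ω₁‖ + 1 / ‖Ω₂‖) ^ p⁻¹
  have hM0 : 0 < M := by positivity
  have hMp : M ^ p = 1 / ‖Ω₁‖ + 1 / ‖Ω₂‖ := by
    simp only [M]
    rw [← Real.rpow_mul (by positivity), inv_mul_cancel₀ hp.ne', Real.rpow_one]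
  set P := max A (min B M)
  have hAP : A ≤ P := le_max_left _ _
  have hPB : P ≤ B := max_le hAB (min_le_left _ _)
  have hP0 : 0 < P := hA.trans_le hAP
  have hI := fun {A B : ℝ} {Ω : ℂ} => intervalIntegrable_exp_phase_div p y Ω (A := A) (B := B)
  rw [← intervalIntegral.integral_add_adjacent_intervals
    ((hI (Ω := Ω₁) hA hAP).sub (hI (Ω := Ω₂) hA hAP))
    ((hI (Ω := Ω₁) hP0 hPB).sub (hI (Ω := Ω₂) hP0 hPB))]
  refine (norm_add_le _ _).trans (add_le_add ?_ ?_)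
  · rcases le_total M A with h | h
    · have : P = A := max_eq_left ((min_le_right _ _).trans h)
      rw [this, intervalIntegral.integral_same, norm_zero]; positivity
    · refine (norm_integral_exp_phase_sub_le hp hre₁ hre₂ hA hAP).trans ?_
      have hPM : P ≤ M := max_le h (min_le_right _ _)
      have : P ^ p ≤ M ^ p := by gcongr
      calc P ^ p * (‖Ω₁‖ + ‖Ω₂‖) / p ≤ M ^ p * (‖Ω₁‖ + ‖Ω₂‖) / p := by gcongr
        _ = (2 + ‖Ω₁‖ / ‖Ω₂‖ + ‖Ω₂‖ / ‖Ω₁‖) / p := by rw [hMp]; field_simp; ring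
        _ ≤ _ := by
          gcongr
          · exact ((div_le_iff₀ n2).2 hK₁).trans (le_abs_self _)
          · exact ((div_le_iff₀ n1).2 hK₂).trans (le_abs_self _)
  · rcases le_total B M with h | h
    · have : P = B := by simp only [P]; rw [min_eq_left h, max_eq_right hAB]
      rw [this, intervalIntegral.integral_same, norm_zero]; positivity
    · have hMP : M ≤ P := (le_min h le_rfl).trans (le_max_right _ _)
      have hMP' : M ^ p ≤ P ^ p := by gcongr
      rw [intervalIntegral.integral_sub (hI hP0 hPB) (hI hP0 hPB)]
      refine (norm_sub_le _ _).trans (add_le_add ?_ ?_)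
      · refine hC y Ω₁ h0.1 hre₁ P B hP0 hPB ?_
        refine le_trans ?_ (mul_le_mul_of_nonneg_right hMP' n1.le)
        rw [hMp, add_mul, one_div_mul_cancel n1.ne']
        exact le_add_of_nonneg_right (by positivity)
      · refine hC y Ω₂ h0.2 hre₂ P B hP0 hPB ?_
        refine le_trans ?_ (mul_le_mul_of_nonneg_right hMP' n2.le)
        rw [hMp, add_mul, one_div_mul_cancel n2.ne']
        exact le_add_of_nonneg_left (by positivity)

/-! ### Fourier multipliers with bounded Fourier transform -/

section Multiplier

variable {V : Type*} [NormedAddCommGroup V] [InnerProductSpace ℝ V] [MeasurableSpace V]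
  [BorelSpace V] [FiniteDimensional ℝ V]

lemma integral_fourier_mul_eq {F g : V → ℂ} (hF : Integrable F) (hg : Integrable g) :
    ∫ p, 𝓕 F p * g p = ∫ x, F x * 𝓕 g x := by
  simpa using! (VectorFourier.integral_fourierIntegral_smul_eq_flip (L := innerₗ V)
    Real.continuous_fourierChar continuous_inner hF hg)

lemma norm_fourier_le_integral_norm (F : V → ℂ) (p : V) : ‖𝓕 F p‖ ≤ ∫ x, ‖F x‖ :=
  VectorFourier.norm_fourierIntegral_le_integral_norm _ _ _ _ _

lemma continuous_fourier {F : V → ℂ} (hF : Integrable F) : Continuous (𝓕 F) :=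
  VectorFourier.fourierIntegral_continuous Real.continuous_fourierChar
    (by exact continuous_inner) hF

lemma fourier_conj_modulation (m : V → ℂ) (x y : V) :
    𝓕 (fun p => conj (exp (↑(-2 * Real.pi * inner ℝ p x) * I) * m p)) y
      = conj (𝓕 m (x - y)) := by
  rw [Real.fourier_eq', Real.fourier_eq', ← integral_conj]
  congr 1
  ext p
  simp only [smul_eq_mul, map_mul, ← exp_conj, conj_ofReal, conj_I, ← mul_assoc]
  rw [← exp_add]
  congr 2
  rw [inner_sub_right]
  push_cast
  ring

/-- The multiplication formula turns the left side into a convolution-type integral of G against the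
Fourier transform of m, which is bounded by `C`. -/
lemma norm_fourier_mul_conj_fourier_le {m G : V → ℂ} (hm : Integrable m) (hG : Integrable G)
    {C : ℝ} (hC : ∀ x, ‖𝓕 m x‖ ≤ C) (x : V) :
    ‖𝓕 (fun p => m p * conj (𝓕 G p)) x‖ ≤ C * ∫ y, ‖G y‖ := by
  have hint : Integrable (fun p => conj (exp (↑(-2 * Real.pi * inner ℝ p x) * I) * m p)) := by
    have hcont : Continuous fun p : V => exp (↑(-2 * Real.pi * inner ℝ p x) * I) := by
      fun_prop
    refine (hm.norm).mono' ?_ (Eventually.of_forall fun p => ?_)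
    · exact continuous_conj.comp_aestronglyMeasurable
        (hcont.aestronglyMeasurable.mul hm.aestronglyMeasurable)
    · rw [RCLike.norm_conj, norm_mul, norm_exp_ofReal_mul_I, one_mul]
  have key : 𝓕 (fun p => m p * conj (𝓕 G p)) x = conj (∫ y, G y * conj (𝓕 m (x - y))) := by
    rw [Real.fourier_eq']
    simp_rw [← fourier_conj_modulation]
    rw [← integral_fourier_mul_eq hG hint, ← integral_conj]
    congr 1
    ext p
    simp only [map_mul, conj_conj, smul_eq_mul]
    ring
  rw [key, RCLike.norm_conj, ← integral_const_mul]
  refine norm_integral_le_of_norm_le (hG.norm.const_mul C) (Eventually.of_forall fun y => ?_)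
  rw [norm_mul, RCLike.norm_conj, mul_comm]
  gcongr
  exact hC _

/-- An integrable multiplier with bounded Fourier transform defines a bounded bilinear form on
`L₁ × L₁`. -/
theorem norm_integral_mul_fourier_le {m F G : V → ℂ} (hm : Integrable m) (hF : Integrable F)
    (hG : Integrable G) {C : ℝ} (hC : ∀ x, ‖𝓕 m x‖ ≤ C) :
    ‖∫ p, m p * (𝓕 F p * conj (𝓕 G p))‖ ≤ C * (∫ x, ‖F x‖) * ∫ x, ‖G x‖ := by
  have hmG : Integrable (fun p => m p * conj (𝓕 G p)) :=
    hm.mul_bdd (c := ∫ x, ‖G x‖)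
      (continuous_conj.comp (continuous_fourier hG)).aestronglyMeasurable
      (Eventually.of_forall fun p => by
        rw [RCLike.norm_conj]; exact norm_fourier_le_integral_norm G p)
  have h1 : ∫ p, m p * (𝓕 F p * conj (𝓕 G p)) = ∫ x, F x * 𝓕 (fun p => m p * conj (𝓕 G p)) x := by
    rw [← integral_fourier_mul_eq hF hmG]
    congr 1; ext p; ring
  rw [h1, show C * (∫ x, ‖F x‖) * ∫ x, ‖G x‖ = (∫ x, ‖F x‖) * (C * ∫ x, ‖G x‖) by ring,
    ← integral_mul_const]
  refine norm_integral_le_of_norm_le (hF.norm.mul_const _) (Eventually.of_forall fun x => ?_)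
  rw [norm_mul]
  gcongr
  exact norm_fourier_mul_conj_fourier_le hm hG hC x

end Multiplier

/-! ### Coordinates on the plane -/

lemma measurePreserving_coords {i j : Fin 2} (hij : i ≠ j) :
    MeasurePreserving (fun p : Plane => (p i, p j)) volume (volume.prod volume) := by
  have h0 : MeasurePreserving (fun p : Plane => (p 0, p 1)) volume (volume.prod volume) :=
    (volume_preserving_finTwoArrow ℝ).comp
      (EuclideanSpace.volume_preserving_symm_measurableEquiv_toLp (Fin 2))
  have hcases : (i = 0 ∧ j = 1) ∨ (i = 1 ∧ j = 0) := by
    fin_cases i <;> fin_cases j <;> simp_all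
  rcases hcases with ⟨rfl, rfl⟩ | ⟨rfl, rfl⟩
  · exact h0
  · exact Measure.measurePreserving_swap.comp h0

lemma inner_plane {i j : Fin 2} (hij : i ≠ j) (p x : Plane) :
    inner ℝ p x = p i * x i + p j * x j := by
  have hcases : (i = 0 ∧ j = 1) ∨ (i = 1 ∧ j = 0) := by
    fin_cases i <;> fin_cases j <;> simp_all
  rcases hcases with ⟨rfl, rfl⟩ | ⟨rfl, rfl⟩ <;>
    simp [PiLp.inner_apply, Fin.sum_univ_two] <;> ring

lemma integrable_comp_coords {i j : Fin 2} (hij : i ≠ j) {M : ℝ → ℝ → ℂ}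
    (hM : Integrable (fun q : ℝ × ℝ => M q.1 q.2) (volume.prod volume)) :
    Integrable (fun p : Plane => M (p i) (p j)) :=
  (measurePreserving_coords hij).integrable_comp_of_integrable hM

/-- Fubini, with the transform in the first argument of `M` taken first. Keeping `i`, `j` general
lets either coordinate play the role of ξ. -/
lemma fourier_comp_coords {i j : Fin 2} (hij : i ≠ j) {M : ℝ → ℝ → ℂ}
    (hM : Integrable (fun q : ℝ × ℝ => M q.1 q.2) (volume.prod volume)) (x : Plane) :
    𝓕 (fun p : Plane => M (p i) (p j)) x
      = ∫ η : ℝ, exp (↑(-2 * Real.pi * (η * x j)) * I) * 𝓕 (fun ξ => M ξ η) (x i) := by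
  set Φ : ℝ × ℝ → ℂ := fun q =>
    exp (↑(-2 * Real.pi * (q.1 * x i + q.2 * x j)) * I) * M q.1 q.2 with hΦ
  have hcont : Continuous fun q : ℝ × ℝ => exp (↑(-2 * Real.pi * (q.1 * x i + q.2 * x j)) * I) := by
    fun_prop
  have hΦi : Integrable Φ (volume.prod volume) := by
    refine hM.norm.mono' (hcont.aestronglyMeasurable.mul hM.aestronglyMeasurable)
      (Eventually.of_forall fun q => ?_)
    rw [norm_mul, norm_exp_ofReal_mul_I, one_mul]
  have h1 : 𝓕 (fun p : Plane => M (p i) (p j)) x = ∫ p : Plane, Φ (p i, p j) := by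
    rw [Real.fourier_eq']
    congr 1; ext p
    rw [inner_plane hij, smul_eq_mul]
  have h2 : ∫ p : Plane, Φ (p i, p j) = ∫ q, Φ q ∂(volume.prod volume) := by
    rw [← (measurePreserving_coords hij).map_eq] at hΦi ⊢
    exact (integral_map (measurePreserving_coords hij).measurable.aemeasurable
      hΦi.aestronglyMeasurable).symm
  rw [h1, h2, integral_prod_symm _ hΦi]
  congr 1; ext η
  rw [Real.fourier_eq', ← integral_const_mul]
  congr 1; ext ξ
  simp only [hΦ, smul_eq_mul, RCLike.inner_apply, conj_trivial]
  rw [← mul_assoc, ← exp_add]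
  congr 2
  push_cast; ring

/-! ### Differences of simple fractions -/

/-- The difference `1 / (ξ - ρ₁) - 1 / (ξ - ρ₂)`. -/
noncomputable def fracDiff (ρ₁ ρ₂ : ℂ) (ξ : ℝ) : ℂ := ((ξ : ℂ) - ρ₁)⁻¹ - ((ξ : ℂ) - ρ₂)⁻¹

lemma ofReal_sub_ne_zero {ρ : ℂ} (hρ : ρ.im ≠ 0) (ξ : ℝ) : (ξ : ℂ) - ρ ≠ 0 := by
  intro h
  apply hρ
  have := congrArg im h
  simpa using this

lemma one_add_sq_le {P q : ℝ} (hq : 0 < q) {ρ : ℂ} (hP : ‖ρ‖ ≤ P) (him : q ≤ |ρ.im|) (ξ : ℝ) :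
    1 + ξ ^ 2 ≤ (2 + (2 * P ^ 2 + 1) / q ^ 2) * ‖(ξ : ℂ) - ρ‖ ^ 2 := by
  have h1 : q ≤ ‖(ξ : ℂ) - ρ‖ := by
    refine him.trans ?_
    have := abs_im_le_norm ((ξ : ℂ) - ρ)
    simpa using this
  have h2 : |ξ| ≤ ‖(ξ : ℂ) - ρ‖ + P := by
    have := norm_add_le ((ξ : ℂ) - ρ) ρ
    rw [sub_add_cancel, norm_real, Real.norm_eq_abs] at this
    linarith
  set n := ‖(ξ : ℂ) - ρ‖
  have h3 : ξ ^ 2 ≤ 2 * n ^ 2 + 2 * P ^ 2 := by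
    have : |ξ| ^ 2 ≤ (n + P) ^ 2 := by gcongr
    rw [sq_abs] at this
    nlinarith [sq_nonneg (n - P)]
  have h4 : q ^ 2 ≤ n ^ 2 := by gcongr
  have h5 : 2 * P ^ 2 + 1 ≤ (2 * P ^ 2 + 1) / q ^ 2 * n ^ 2 := by
    rw [div_mul_eq_mul_div, le_div_iff₀ (by positivity)]
    gcongr
  nlinarith

/-- Subtracting two simple fractions gains a power of decay: each alone is not integrable, the
difference is. -/
lemma norm_fracDiff_le {P q : ℝ} (hq : 0 < q) {ρ₁ ρ₂ : ℂ} (hP₁ : ‖ρ₁‖ ≤ P) (hP₂ : ‖ρ₂‖ ≤ P)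
    (h₁ : q ≤ |ρ₁.im|) (h₂ : q ≤ |ρ₂.im|) (ξ : ℝ) :
    ‖fracDiff ρ₁ ρ₂ ξ‖ ≤ 2 * P * (2 + (2 * P ^ 2 + 1) / q ^ 2) * (1 + ξ ^ 2)⁻¹ := by
  have hP : 0 ≤ P := (norm_nonneg _).trans hP₁
  have n1 := ofReal_sub_ne_zero (ρ := ρ₁) (abs_pos.1 (hq.trans_le h₁)) ξ
  have n2 := ofReal_sub_ne_zero (ρ := ρ₂) (abs_pos.1 (hq.trans_le h₂)) ξ
  have b1 := one_add_sq_le hq hP₁ h₁ ξ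
  have b2 := one_add_sq_le hq hP₂ h₂ ξ
  have p1 := norm_pos_iff.2 n1
  have p2 := norm_pos_iff.2 n2
  set K := 2 + (2 * P ^ 2 + 1) / q ^ 2
  have hK : 0 < K := by positivity
  have e : fracDiff ρ₁ ρ₂ ξ = (ρ₁ - ρ₂) * (((ξ : ℂ) - ρ₁)⁻¹ * ((ξ : ℂ) - ρ₂)⁻¹) := by
    rw [fracDiff]; field_simp; ring
  rw [e, norm_mul, norm_mul, norm_inv, norm_inv, mul_assoc]
  refine mul_le_mul ((norm_sub_le _ _).trans (by linarith)) ?_ (by positivity) (by positivity)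
  · rw [← mul_inv, ← div_eq_mul_inv, inv_le_comm₀ (by positivity) (by positivity), inv_div,
      div_le_iff₀ hK]
    refine le_of_sq_le_sq ?_ (by positivity)
    calc (1 + ξ ^ 2) ^ 2 = (1 + ξ ^ 2) * (1 + ξ ^ 2) := by ring
      _ ≤ (K * ‖(ξ : ℂ) - ρ₁‖ ^ 2) * (K * ‖(ξ : ℂ) - ρ₂‖ ^ 2) := by gcongr
      _ = _ := by ring

lemma continuous_fracDiff {ρ₁ ρ₂ : ℂ} (h₁ : ρ₁.im ≠ 0) (h₂ : ρ₂.im ≠ 0) :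
    Continuous (fracDiff ρ₁ ρ₂) :=
  ((continuous_ofReal.sub continuous_const).inv₀ (ofReal_sub_ne_zero h₁)).sub
    ((continuous_ofReal.sub continuous_const).inv₀ (ofReal_sub_ne_zero h₂))

lemma integrable_fracDiff {ρ₁ ρ₂ : ℂ} (h₁ : ρ₁.im ≠ 0) (h₂ : ρ₂.im ≠ 0) :
    Integrable (fracDiff ρ₁ ρ₂) :=
  (integrable_inv_one_add_sq.const_mul _).mono' (continuous_fracDiff h₁ h₂).aestronglyMeasurable
    (Eventually.of_forall fun ξ => norm_fracDiff_le (P := max ‖ρ₁‖ ‖ρ₂‖)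
      (q := min |ρ₁.im| |ρ₂.im|) (lt_min (abs_pos.2 h₁) (abs_pos.2 h₂)) (le_max_left _ _)
      (le_max_right _ _) (min_le_left _ _) (min_le_right _ _) ξ)

/-- The causal exponential `exp (2 π i ρ max(t, 0))`. -/
noncomputable def causalExp (ρ : ℂ) (t : ℝ) : ℂ :=
  exp (2 * Real.pi * I * ρ * ((max t 0 : ℝ) : ℂ))

lemma continuous_causalExp (ρ : ℂ) : Continuous (causalExp ρ) := by
  unfold causalExp; fun_prop

lemma causalExp_of_nonpos (ρ : ℂ) {t : ℝ} (ht : t ≤ 0) : causalExp ρ t = 1 := by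
  simp [causalExp, max_eq_right ht]

lemma two_pi_I_mul_re (ρ : ℂ) : (2 * Real.pi * I * ρ).re = -(2 * Real.pi * ρ.im) := by
  simp [mul_re, mul_im]

lemma integrableOn_causalExp {ρ : ℂ} (hρ : 0 < ρ.im) : IntegrableOn (causalExp ρ) (Ioi 0) := by
  have h : (2 * Real.pi * I * ρ).re < 0 := by
    rw [two_pi_I_mul_re]; have := Real.pi_pos; nlinarith [mul_pos this hρ]
  refine (integrableOn_exp_mul_complex_Ioi h 0).congr_fun (fun t ht => ?_) measurableSet_Ioi
  simp only [causalExp, max_eq_left (le_of_lt (mem_Ioi.1 ht))]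

lemma causalExp_sub_eq_indicator (ρ₁ ρ₂ : ℂ) :
    (fun t => causalExp ρ₁ t - causalExp ρ₂ t)
      = (Ioi (0 : ℝ)).indicator (fun t => causalExp ρ₁ t - causalExp ρ₂ t) := by
  ext t
  by_cases ht : t ∈ Ioi (0 : ℝ)
  · rw [indicator_of_mem ht]
  · rw [indicator_of_notMem ht, causalExp_of_nonpos _ (not_lt.1 ht),
      causalExp_of_nonpos _ (not_lt.1 ht), sub_self]

lemma integral_Ioi_exp_mul_causalExp {ρ : ℂ} (hρ : 0 < ρ.im) (ξ : ℝ) :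
    IntegrableOn (fun t : ℝ => exp (↑(-2 * Real.pi * (ξ * t)) * I) * causalExp ρ t) (Ioi 0) ∧
    ∫ t in Ioi (0 : ℝ), exp (↑(-2 * Real.pi * (ξ * t)) * I) * causalExp ρ t
      = (2 * Real.pi * I)⁻¹ * ((ξ : ℂ) - ρ)⁻¹ := by
  have hre : (2 * Real.pi * I * (ρ - ξ)).re < 0 := by
    rw [two_pi_I_mul_re]; have := Real.pi_pos; simp; positivity
  have heq : ∀ t ∈ Ioi (0 : ℝ), exp (2 * Real.pi * I * (ρ - ξ) * t)
      = exp (↑(-2 * Real.pi * (ξ * t)) * I) * causalExp ρ t := by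
    intro t ht
    rw [causalExp, max_eq_left (le_of_lt (mem_Ioi.1 ht)), ← exp_add]
    congr 1; push_cast; ring
  refine ⟨(integrableOn_exp_mul_complex_Ioi hre 0).congr_fun heq measurableSet_Ioi, ?_⟩
  rw [← setIntegral_congr_fun measurableSet_Ioi heq, integral_exp_mul_complex_Ioi hre]
  rw [ofReal_zero, mul_zero, exp_zero, ← mul_inv, neg_div, one_div, ← inv_neg]
  congr 1; ring

/-- Fourier inversion applied to the difference of causal exponentials. Both equal 1 at 0, so the
difference is continuous and inversion holds pointwise; this requires both poles on the same side.
-/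
lemma fourier_fracDiff_of_im_pos {ρ₁ ρ₂ : ℂ} (h₁ : 0 < ρ₁.im) (h₂ : 0 < ρ₂.im) (x : ℝ) :
    𝓕 (fracDiff ρ₁ ρ₂) x = 2 * Real.pi * I * (causalExp ρ₁ (-x) - causalExp ρ₂ (-x)) := by
  set g : ℝ → ℂ := fun t => causalExp ρ₁ t - causalExp ρ₂ t with hg
  have hgc : Continuous g := (continuous_causalExp ρ₁).sub (continuous_causalExp ρ₂)
  have hgi : Integrable g := by
    rw [hg, causalExp_sub_eq_indicator, integrable_indicator_iff measurableSet_Ioi]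
    exact (integrableOn_causalExp h₁).sub (integrableOn_causalExp h₂)
  have hF : 𝓕 g = fun ξ => (2 * Real.pi * I)⁻¹ * fracDiff ρ₁ ρ₂ ξ := by
    ext ξ
    obtain ⟨i1, e1⟩ := integral_Ioi_exp_mul_causalExp h₁ ξ
    obtain ⟨i2, e2⟩ := integral_Ioi_exp_mul_causalExp h₂ ξ
    rw [Real.fourier_eq', fracDiff, mul_sub, ← e1, ← e2, ← integral_sub i1 i2,
      ← integral_indicator measurableSet_Ioi]
    congr 1; ext t
    have := congrFun (causalExp_sub_eq_indicator ρ₁ ρ₂) t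
    change _ • (causalExp ρ₁ t - causalExp ρ₂ t) = _
    rw [this]
    by_cases ht : t ∈ Ioi (0 : ℝ)
    · simp only [indicator_of_mem ht, smul_eq_mul, RCLike.inner_apply, conj_trivial]
      ring
    · simp only [indicator_of_notMem ht, smul_zero]
  have hFi : Integrable (𝓕 g) := by
    rw [hF]; exact (integrable_fracDiff h₁.ne' h₂.ne').const_mul _
  have inv := congrFun (hgc.fourierInv_fourier_eq hgi hFi) (-x)
  rw [Real.fourierInv_eq_fourier_neg, neg_neg, hF, Real.fourier_eq'] at inv
  change _ = _ * g (-x)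
  rw [← inv, Real.fourier_eq', ← integral_const_mul]
  congr 1; ext ξ
  have : (Real.pi : ℂ) ≠ 0 := by exact_mod_cast Real.pi_ne_zero
  simp only [smul_eq_mul]
  have hI := I_ne_zero
  field_simp

lemma fourier_fracDiff_of_im_neg {ρ₁ ρ₂ : ℂ} (h₁ : ρ₁.im < 0) (h₂ : ρ₂.im < 0) (x : ℝ) :
    𝓕 (fracDiff ρ₁ ρ₂) x
      = -(2 * Real.pi * I) * (causalExp (-ρ₁) x - causalExp (-ρ₂) x) := by
  have h := fourier_fracDiff_of_im_pos (ρ₁ := conj ρ₁) (ρ₂ := conj ρ₂) (by simpa) (by simpa) (-x)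
  have h' : 𝓕 (fracDiff ρ₁ ρ₂) x = conj (𝓕 (fracDiff (conj ρ₁) (conj ρ₂)) (-x)) := by
    rw [Real.fourier_eq', Real.fourier_eq', ← integral_conj]
    congr 1; ext ξ
    simp only [fracDiff, smul_eq_mul, map_mul, map_sub, map_inv₀, conj_conj, conj_ofReal,
      ← exp_conj, conj_I, inner_neg_right]
    congr 2
    push_cast; ring
  rw [h', h]
  simp only [map_mul, map_sub, causalExp, ← exp_conj, conj_conj, conj_ofReal, conj_I, neg_neg,
    map_ofNat]
  ring_nf

/-! ### The truncated kernels -/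

/-- The point `r Re z + i |r| Im z`: the multiple of `z` or `conj z` by `r` whose imaginary part has
the sign of that of `z`. -/
noncomputable def rho (r : ℝ) (z : ℂ) : ℂ := ((r * z.re : ℝ) : ℂ) + ((|r| * z.im : ℝ) : ℂ) * I

@[simp] lemma rho_re (r : ℝ) (z : ℂ) : (rho r z).re = r * z.re := by simp [rho]

@[simp] lemma rho_im (r : ℝ) (z : ℂ) : (rho r z).im = |r| * z.im := by simp [rho]

lemma rho_of_nonneg {r : ℝ} (hr : 0 ≤ r) (z : ℂ) : rho r z = r * z := by
  apply Complex.ext <;> simp [abs_of_nonneg hr]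

lemma rho_of_nonpos {r : ℝ} (hr : r ≤ 0) (z : ℂ) : rho r z = r * conj z := by
  apply Complex.ext <;> simp [abs_of_nonpos hr]

lemma norm_rho (r : ℝ) (z : ℂ) : ‖rho r z‖ = |r| * ‖z‖ := by
  rcases le_total 0 r with h | h
  · rw [rho_of_nonneg h, norm_mul, norm_real, Real.norm_eq_abs]
  · rw [rho_of_nonpos h, norm_mul, norm_real, RCLike.norm_conj, Real.norm_eq_abs]

lemma rho_mul_of_nonneg (r : ℝ) {t : ℝ} (ht : 0 ≤ t) (z : ℂ) : rho (r * t) z = t * rho r z := by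
  apply Complex.ext <;> simp [abs_mul, abs_of_nonneg ht] <;> ring

/-- The function equal to `r η ^ p` for `η ≥ 0` and to `s |η| ^ p` for `η < 0`. -/
noncomputable def branch (r s p η : ℝ) : ℝ := (if 0 ≤ η then r else s) * |η| ^ p

lemma measurable_branch (r s p : ℝ) : Measurable (branch r s p) := by
  unfold branch
  refine (Measurable.ite measurableSet_Ici measurable_const measurable_const).mul ?_
  fun_prop

/-- The annulus `δ ≤ |η| ≤ R`. -/
def annulus (δ R : ℝ) : Set ℝ := {η | δ ≤ |η| ∧ |η| ≤ R}

lemma measurableSet_annulus (δ R : ℝ) : MeasurableSet (annulus δ R) :=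
  (measurableSet_le measurable_const measurable_norm).inter
    (measurableSet_le measurable_norm measurable_const)

lemma abs_branch_le {r s p δ R η : ℝ} (hp : 0 < p) (hη : η ∈ annulus δ R) :
    |branch r s p η| ≤ (|r| + |s|) * R ^ p := by
  have h1 : |η| ^ p ≤ R ^ p := by have := hη.2; gcongr
  rw [branch, abs_mul, abs_of_nonneg (by positivity : 0 ≤ |η| ^ p)]
  have h2 : |if 0 ≤ η then r else s| ≤ |r| + |s| := by
    split_ifs
    · exact le_add_of_nonneg_right (abs_nonneg _)
    · exact le_add_of_nonneg_left (abs_nonneg _)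
  gcongr

lemma le_abs_branch {r s p δ R η : ℝ} (hp : 0 < p) (hδ : 0 < δ) (hη : η ∈ annulus δ R) :
    min |r| |s| * δ ^ p ≤ |branch r s p η| := by
  have h1 : δ ^ p ≤ |η| ^ p := by have := hη.1; gcongr
  rw [branch, abs_mul, abs_of_nonneg (by positivity : 0 ≤ |η| ^ p)]
  have h2 : min |r| |s| ≤ |if 0 ≤ η then r else s| := by
    split_ifs
    · exact min_le_left _ _
    · exact min_le_right _ _
  gcongr

/-- The weight `|η| ^ (l - 1) / η ^ l` truncated to an annulus. -/
noncomputable def weight (l : ℕ) (δ R : ℝ) : ℝ → ℂ :=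
  (annulus δ R).indicator fun η => ((|η| ^ (l - 1) / η ^ l : ℝ) : ℂ)

lemma measurable_weight (l : ℕ) (δ R : ℝ) : Measurable (weight l δ R) :=
  Measurable.indicator (by fun_prop) (measurableSet_annulus δ R)

lemma weight_of_pos {l : ℕ} (hl : 1 ≤ l) {δ R u : ℝ} (hδ : 0 < δ) (h1 : δ ≤ u) (h2 : u ≤ R) :
    weight l δ R u = ((u : ℂ))⁻¹ := by
  have hu : 0 < u := hδ.trans_le h1
  obtain ⟨m, rfl⟩ := Nat.exists_eq_add_of_le' hl
  have hmem : u ∈ annulus δ R := ⟨by rwa [abs_of_pos hu], by rwa [abs_of_pos hu]⟩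
  rw [weight, indicator_of_mem hmem, abs_of_pos hu, ← ofReal_inv]
  congr 1
  rw [Nat.add_sub_cancel, pow_succ]; field_simp

lemma weight_neg (l : ℕ) (δ R η : ℝ) : weight l δ R (-η) = (-1) ^ l * weight l δ R η := by
  by_cases h : η ∈ annulus δ R
  · have h' : -η ∈ annulus δ R := by simpa [annulus] using h
    rw [weight, indicator_of_mem h, indicator_of_mem h', abs_neg, neg_pow]
    rcases Nat.even_or_odd l with e | e
    · simp [e.neg_one_pow]
    · simp [e.neg_one_pow, div_neg]
  · have h' : -η ∉ annulus δ R := by simpa [annulus] using h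
    rw [weight, indicator_of_notMem h, indicator_of_notMem h', mul_zero]

lemma norm_weight_le {l : ℕ} (hl : 1 ≤ l) {δ R : ℝ} (hδ : 0 < δ) (η : ℝ) :
    ‖weight l δ R η‖ ≤ (annulus δ R).indicator (fun _ => δ⁻¹) η := by
  by_cases h : η ∈ annulus δ R
  · rw [weight, indicator_of_mem h, indicator_of_mem h, norm_real, Real.norm_eq_abs, abs_div,
      abs_pow, abs_pow, abs_abs]
    have hη : 0 < |η| := hδ.trans_le h.1
    obtain ⟨m, rfl⟩ := Nat.exists_eq_add_of_le' hl
    rw [Nat.add_sub_cancel, pow_succ, div_mul_eq_div_div, div_self (by positivity), one_div]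
    exact inv_anti₀ hδ h.1
  · rw [weight, indicator_of_notMem h, indicator_of_notMem h, norm_zero]

/-- The truncated kernel attached to the pair of branches `branch r s p` and `branch r' s' p`. -/
noncomputable def kernel (l : ℕ) (p δ R r s r' s' : ℝ) (z : ℂ) (ξ η : ℝ) : ℂ :=
  weight l δ R η * fracDiff (rho (branch r s p η) z) (rho (branch r' s' p η) z) ξ

lemma measurable_kernel (l : ℕ) (p δ R r s r' s' : ℝ) (z : ℂ) :
    Measurable fun q : ℝ × ℝ => kernel l p δ R r s r' s' z q.1 q.2 := by
  have h : ∀ r s : ℝ, Measurable fun q : ℝ × ℝ => rho (branch r s p q.2) z := by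
    intro r s
    have := (measurable_branch r s p).comp (measurable_snd : Measurable (Prod.snd : ℝ × ℝ → ℝ))
    have h2 : Measurable fun b : ℝ => rho b z := by unfold rho; fun_prop
    exact h2.comp this
  have hw := (measurable_weight l δ R).comp (measurable_snd : Measurable (Prod.snd : ℝ × ℝ → ℝ))
  have hx : Measurable fun q : ℝ × ℝ => (q.1 : ℂ) := by fun_prop
  exact hw.mul (((hx.sub (h r s)).inv).sub ((hx.sub (h r' s')).inv))

lemma integrable_kernel {l : ℕ} (hl : 1 ≤ l) {p δ R r s r' s' : ℝ} (hp : 0 < p) (hδ : 0 < δ)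
    (hr : r ≠ 0) (hs : s ≠ 0) (hr' : r' ≠ 0) (hs' : s' ≠ 0) {z : ℂ}
    (hz : z.im ≠ 0) :
    Integrable (fun q : ℝ × ℝ => kernel l p δ R r s r' s' z q.1 q.2) (volume.prod volume) := by
  set m := min (min |r| |s|) (min |r'| |s'|)
  set P := ((|r| + |s|) * R ^ p + (|r'| + |s'|) * R ^ p) * ‖z‖
  set q₀ := m * δ ^ p * |z.im|
  have hm : 0 < m := by simp [m, hr, hs, hr', hs']
  have hq : 0 < q₀ := by positivity
  set K := 2 * P * (2 + (2 * P ^ 2 + 1) / q₀ ^ 2)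
  have hdom : Integrable (fun q : ℝ × ℝ => (1 + q.1 ^ 2)⁻¹ *
      (annulus δ R).indicator (fun _ => δ⁻¹ * K) q.2) (volume.prod volume) := by
    refine integrable_inv_one_add_sq.mul_prod ?_
    rw [integrable_indicator_iff (measurableSet_annulus δ R)]
    refine integrableOn_const (ne_top_of_le_ne_top ?_ (measure_mono (t := Icc (-R) R) ?_))
    · simp
    · exact fun η hη => abs_le.1 hη.2
  refine hdom.mono' (measurable_kernel l p δ R r s r' s' z).aestronglyMeasurable
    (Eventually.of_forall fun q => ?_)
  rw [kernel, norm_mul]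
  by_cases hη : q.2 ∈ annulus δ R
  · have hw := norm_weight_le hl (R := R) hδ q.2
    rw [indicator_of_mem hη] at hw ⊢
    have hRp : 0 ≤ R ^ p := Real.rpow_nonneg ((abs_nonneg _).trans hη.2) _
    have hf : ‖fracDiff (rho (branch r s p q.2) z) (rho (branch r' s' p q.2) z) q.1‖
        ≤ K * (1 + q.1 ^ 2)⁻¹ := by
      refine norm_fracDiff_le hq ?_ ?_ ?_ ?_ q.1
      · rw [norm_rho]
        have := abs_branch_le (r := r) (s := s) hp hη
        refine mul_le_mul_of_nonneg_right (this.trans ?_) (norm_nonneg _)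
        exact le_add_of_nonneg_right (by positivity)
      · rw [norm_rho]
        have := abs_branch_le (r := r') (s := s') hp hη
        refine mul_le_mul_of_nonneg_right (this.trans ?_) (norm_nonneg _)
        exact le_add_of_nonneg_left (by positivity)
      · rw [rho_im, abs_mul, abs_abs]
        refine mul_le_mul_of_nonneg_right (le_trans ?_ (le_abs_branch hp hδ hη)) (abs_nonneg _)
        gcongr
        exact min_le_left _ _
      · rw [rho_im, abs_mul, abs_abs]
        refine mul_le_mul_of_nonneg_right (le_trans ?_ (le_abs_branch hp hδ hη)) (abs_nonneg _)
        gcongr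
        exact min_le_right _ _
    calc _ ≤ δ⁻¹ * (K * (1 + q.1 ^ 2)⁻¹) := by gcongr
      _ = _ := by ring
  · rw [weight, indicator_of_notMem hη, indicator_of_notMem hη, norm_zero, zero_mul, mul_zero]

/-- One formula for both half-planes and both signs of x. Since Im(`rho A z`) never changes sign
with A, the same θ gives decay for all A; when x lies on the inactive side, θ = 0. -/
lemma exists_fourier_fracDiff_rho {z : ℂ} (hz : z.im ≠ 0) (x : ℝ) :
    ∃ c θ : ℂ, ‖c‖ = 2 * Real.pi ∧ (∀ A : ℝ, (θ * rho A z).re ≤ 0) ∧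
      ∀ A B : ℝ, A ≠ 0 → B ≠ 0 → 𝓕 (fracDiff (rho A z) (rho B z)) x
        = c * (exp (θ * rho A z) - exp (θ * rho B z)) := by
  have hpi := Real.pi_pos
  rcases lt_or_gt_of_ne hz with h | h
  · refine ⟨-(2 * Real.pi * I), -(2 * Real.pi * I * ((max x 0 : ℝ) : ℂ)), ?_, fun A => ?_,
      fun A B hA hB => ?_⟩
    · simp [abs_of_pos hpi]
    · have : 0 ≤ max x 0 := le_max_right _ _
      have h2 : (-(2 * Real.pi * I * ((max x 0 : ℝ) : ℂ)) * rho A z).re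
          = 2 * Real.pi * max x 0 * (|A| * z.im) := by
        simp [mul_re, mul_im]
      rw [h2]
      exact mul_nonpos_of_nonneg_of_nonpos (by positivity)
        (mul_nonpos_of_nonneg_of_nonpos (abs_nonneg _) h.le)
    · have hA' := abs_pos.2 hA
      have hB' := abs_pos.2 hB
      rw [fourier_fracDiff_of_im_neg (by rw [rho_im]; exact mul_neg_of_pos_of_neg hA' h)
        (by rw [rho_im]; exact mul_neg_of_pos_of_neg hB' h), causalExp, causalExp]
      ring_nf
  · refine ⟨2 * Real.pi * I, 2 * Real.pi * I * ((max (-x) 0 : ℝ) : ℂ), ?_, fun A => ?_,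
      fun A B hA hB => ?_⟩
    · simp [abs_of_pos hpi]
    · have : 0 ≤ max (-x) 0 := le_max_right _ _
      have h2 : (2 * Real.pi * I * ((max (-x) 0 : ℝ) : ℂ) * rho A z).re
          = -(2 * Real.pi * max (-x) 0 * (|A| * z.im)) := by
        simp [mul_re, mul_im]
      rw [h2, neg_nonpos]
      positivity
    · have hA' := abs_pos.2 hA
      have hB' := abs_pos.2 hB
      rw [fourier_fracDiff_of_im_pos (by rw [rho_im]; positivity) (by rw [rho_im]; positivity),
        causalExp, causalExp]
      ring_nf

lemma integral_annulus_eq {δ R : ℝ} (hδ : 0 < δ) (hδR : δ ≤ R) {f : ℝ → ℂ}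
    (hf : Integrable f) (h0 : ∀ η ∉ annulus δ R, f η = 0) :
    ∫ η, f η = (∫ u in δ..R, f u) + ∫ u in δ..R, f (-u) := by
  have h1 : ∫ η, f η = (∫ η in Ioi (0 : ℝ), f η) + ∫ η in Ioi (0 : ℝ), f (-η) := by
    rw [integral_comp_neg_Ioi, neg_zero, add_comm,
      intervalIntegral.integral_Iic_add_Ioi hf.integrableOn hf.integrableOn]
  have h2 : ∀ g : ℝ → ℂ, (∀ η ∉ annulus δ R, g η = 0) →
      ∫ η in Ioi (0 : ℝ), g η = ∫ u in δ..R, g u := by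
    intro g hg
    rw [intervalIntegral.integral_of_le hδR, ← integral_Icc_eq_integral_Ioc]
    refine setIntegral_eq_of_subset_of_forall_sdiff_eq_zero measurableSet_Ioi
      (fun u hu => hδ.trans_le hu.1) fun u hu => hg u fun hu' => hu.2 ?_
    have hu0 : 0 < u := hu.1
    rwa [annulus, mem_ofPred_eq, abs_of_pos hu0] at hu'
  rw [h1, h2 f h0, h2 (fun η => f (-η)) fun η hη => h0 _ (by simpa [annulus] using hη)]

/-- The Fourier transforms of the truncated kernels are uniformly bounded. -/
theorem exists_norm_fourier_kernel_le {p r s r' s' : ℝ} (hp : 0 < p) (hp1 : p ≠ 1)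
    (hr : r ≠ 0) (hs : s ≠ 0) (hr' : r' ≠ 0) (hs' : s' ≠ 0) :
    ∃ C : ℝ, 0 ≤ C ∧ ∀ {l : ℕ}, 1 ≤ l → ∀ {δ R : ℝ}, 0 < δ → δ ≤ R → ∀ {z : ℂ}, z.im ≠ 0 →
      ∀ {i j : Fin 2}, i ≠ j → ∀ x : Plane,
        ‖𝓕 (fun q : Plane => kernel l p δ R r s r' s' z (q i) (q j)) x‖ ≤ C := by
  -- Bounds the ratios of the two Ω's in both directions on both half-lines. The factor ‖z‖ cancels
  -- in them, so the final constant does not depend on z.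
  set K := |r| / |r'| + |r'| / |r| + |s| / |s'| + |s'| / |s|
  obtain ⟨C, hC0, hC⟩ := exists_norm_integral_exp_phase_sub_le hp hp1 K
  refine ⟨2 * Real.pi * C + 2 * Real.pi * C, by positivity,
    fun {l} hl {δ R} hδ hδR {z} hz {i j} hij x => ?_⟩
  obtain ⟨c, θ, hc, hre, hF⟩ := exists_fourier_fracDiff_rho hz (x i)
  have hrat : ∀ a b : ℝ, b ≠ 0 → |a| / |b| ≤ K → ‖θ * rho a z‖ ≤ K * ‖θ * rho b z‖ := by
    intro a b hb hab
    rw [norm_mul, norm_mul, norm_rho, norm_rho]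
    have : |a| ≤ K * |b| := by rwa [div_le_iff₀ (abs_pos.2 hb)] at hab
    calc ‖θ‖ * (|a| * ‖z‖) ≤ ‖θ‖ * ((K * |b|) * ‖z‖) := by gcongr
      _ = _ := by ring
  have t1 : 0 ≤ |r| / |r'| := by positivity
  have t2 : 0 ≤ |r'| / |r| := by positivity
  have t3 : 0 ≤ |s| / |s'| := by positivity
  have t4 : 0 ≤ |s'| / |s| := by positivity
  have hMi := integrable_kernel hl (R := R) hp hδ hr hs hr' hs' hz
  rw [fourier_comp_coords hij hMi]
  set f : ℝ → ℂ := fun η => exp (↑(-2 * Real.pi * (η * x j)) * I) *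
    𝓕 (fun ξ => kernel l p δ R r s r' s' z ξ η) (x i) with hf
  have hfF : ∀ η, f η = exp (↑(-2 * Real.pi * (η * x j)) * I) * (weight l δ R η *
      𝓕 (fracDiff (rho (branch r s p η) z) (rho (branch r' s' p η) z)) (x i)) := by
    intro η
    simp only [hf]
    congr 1
    rw [Real.fourier_eq', Real.fourier_eq', ← integral_const_mul]
    congr 1; ext ξ
    simp only [kernel, smul_eq_mul]; ring
  have hzero : ∀ η ∉ annulus δ R, f η = 0 := by
    intro η hη
    rw [hfF, weight, indicator_of_notMem hη, zero_mul, mul_zero]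
  have hfi : Integrable f := by
    have hΦ : Integrable (fun q : ℝ × ℝ => exp (↑(-2 * Real.pi * (q.1 * x i + q.2 * x j)) * I) *
        kernel l p δ R r s r' s' z q.1 q.2) (volume.prod volume) := by
      refine hMi.norm.mono' (Continuous.aestronglyMeasurable (by fun_prop) |>.mul
        hMi.aestronglyMeasurable) (Eventually.of_forall fun q => ?_)
      rw [norm_mul, norm_exp_ofReal_mul_I, one_mul]
    refine hΦ.integral_prod_right.congr (Eventually.of_forall fun η => ?_)
    simp only [hf]
    rw [Real.fourier_eq', ← integral_const_mul]
    congr 1; ext ξ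
    simp only [smul_eq_mul, RCLike.inner_apply, conj_trivial]
    rw [← mul_assoc, ← exp_add]
    congr 2; push_cast; ring
  have hbr : ∀ (r s u : ℝ), 0 < u → branch r s p u = r * u ^ p := fun r s u hu => by
    rw [branch, if_pos hu.le, abs_of_pos hu]
  have hbr' : ∀ (r s u : ℝ), 0 < u → branch r s p (-u) = s * u ^ p := fun r s u hu => by
    rw [branch, if_neg (by linarith), abs_neg, abs_of_pos hu]
  have hval : ∀ (a b y : ℝ) (e : ℂ), ‖e‖ = 2 * Real.pi → |a| / |b| ≤ K → |b| / |a| ≤ K →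
      a ≠ 0 → b ≠ 0 → ∀ g : ℝ → ℂ, (∀ u ∈ uIcc δ R, g u = e * (exp (phase p y (θ * rho a z) u) *
        ((u : ℂ))⁻¹ - exp (phase p y (θ * rho b z) u) * ((u : ℂ))⁻¹)) →
      ‖∫ u in δ..R, g u‖ ≤ 2 * Real.pi * C := by
    intro a b y e he h1 h2 ha hb g hg
    rw [intervalIntegral.integral_congr hg, intervalIntegral.integral_const_mul, norm_mul, he]
    gcongr
    exact hC y _ _ (hre a) (hre b) (hrat a b hb h1) (hrat b a ha h2) δ R hδ hδR
  rw [integral_annulus_eq hδ hδR hfi hzero]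
  refine (norm_add_le _ _).trans (add_le_add ?_ ?_)
  · refine hval r r' (-2 * Real.pi * x j) c hc (by linarith) (by linarith) hr hr' _ fun u hu => ?_
    rw [uIcc_of_le hδR] at hu
    have hu0 : 0 < u := hδ.trans_le hu.1
    have hup : u ^ p ≠ 0 := (Real.rpow_pos_of_pos hu0 p).ne'
    rw [hfF, weight_of_pos hl hδ hu.1 hu.2, hbr r s u hu0, hbr r' s' u hu0,
      hF _ _ (mul_ne_zero hr hup) (mul_ne_zero hr' hup), rho_mul_of_nonneg _ (by positivity),
      rho_mul_of_nonneg _ (by positivity), phase, phase, exp_add, exp_add]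
    push_cast
    ring_nf
  -- On the negative half-line the frequency changes sign and the weight contributes (-1)ˡ.
  · refine hval s s' (2 * Real.pi * x j) ((-1) ^ l * c) (by simp [hc]) (by linarith) (by linarith)
      hs hs' _ fun u hu => ?_
    rw [uIcc_of_le hδR] at hu
    have hu0 : 0 < u := hδ.trans_le hu.1
    have hup : u ^ p ≠ 0 := (Real.rpow_pos_of_pos hu0 p).ne'
    rw [hfF, weight_neg, weight_of_pos hl hδ hu.1 hu.2, hbr' r s u hu0, hbr' r' s' u hu0,
      hF _ _ (mul_ne_zero hs hup) (mul_ne_zero hs' hup), rho_mul_of_nonneg _ (by positivity),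
      rho_mul_of_nonneg _ (by positivity), phase, phase, exp_add, exp_add]
    push_cast
    ring_nf

/-! ### Sums over roots of unity -/

/-- The `n`-th power of the standard primitive `k`-th root of unity. -/
noncomputable def unityRoot (k n : ℕ) : ℂ := exp (2 * Real.pi * I / (k : ℂ)) ^ n

lemma unityRoot_pow {k : ℕ} (hk : k ≠ 0) (n : ℕ) : unityRoot k n ^ k = 1 := by
  rw [unityRoot, ← pow_mul, mul_comm n, pow_mul, (isPrimitiveRoot_exp k hk).pow_eq_one, one_pow]

lemma norm_unityRoot {k : ℕ} (hk : k ≠ 0) (n : ℕ) : ‖unityRoot k n‖ = 1 :=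
  norm_eq_one_of_pow_eq_one (unityRoot_pow hk n) hk

lemma sum_unityRoot_pow {k m : ℕ} (hm : m < k) :
    ∑ n ∈ Finset.range k, unityRoot k n ^ m = if m = 0 then (k : ℂ) else 0 := by
  split_ifs with h
  · simp [h]
  · have hk : k ≠ 0 := by omega
    have hprim := isPrimitiveRoot_exp k hk
    have hne : exp (2 * Real.pi * I / k) ^ m ≠ 1 := hprim.pow_ne_one_of_pos_of_lt h hm
    have : ∀ n ∈ Finset.range k, unityRoot k n ^ m = (exp (2 * Real.pi * I / k) ^ m) ^ n :=
      fun n _ => by rw [unityRoot, ← pow_mul, ← pow_mul, mul_comm n]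
    rw [Finset.sum_congr rfl this, geom_sum_eq hne, ← pow_mul, mul_comm m, pow_mul, hprim.pow_eq_one,
      one_pow, sub_self, zero_div]

lemma rho_pow {k : ℕ} {z : ℂ} (hz : z ^ k = 1) (r : ℝ) : rho r z ^ k = (r : ℂ) ^ k := by
  rcases le_total 0 r with h | h
  · rw [rho_of_nonneg h, mul_pow, hz, mul_one]
  · rw [rho_of_nonpos h, mul_pow, ← map_pow, hz, map_one, mul_one]

lemma sum_rho_pow {k m : ℕ} (hm : m < k) (r : ℝ) :
    ∑ n ∈ Finset.range k, rho r (unityRoot k n) ^ m = if m = 0 then (k : ℂ) else 0 := by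
  rcases le_total 0 r with h | h
  · simp_rw [rho_of_nonneg h, mul_pow, ← Finset.mul_sum, sum_unityRoot_pow hm]
    split_ifs with h0 <;> simp [h0]
  · simp_rw [rho_of_nonpos h, mul_pow, ← map_pow, ← Finset.mul_sum, ← map_sum,
      sum_unityRoot_pow hm]
    split_ifs with h0 <;> simp [h0]

lemma inv_sub_rho_eq {k : ℕ} {z : ℂ} (hz : z ^ k = 1) {r ξ : ℝ} (h : ξ ^ k ≠ r ^ k) :
    ((ξ : ℂ) - rho r z)⁻¹
      = (∑ m ∈ Finset.range k, (ξ : ℂ) ^ m * rho r z ^ (k - 1 - m)) / ((ξ : ℂ) ^ k - (r : ℂ) ^ k) := by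
  have h1 := geom_sum₂_mul (ξ : ℂ) (rho r z) k
  rw [rho_pow hz] at h1
  have h2 : (ξ : ℂ) ^ k - (r : ℂ) ^ k ≠ 0 := sub_ne_zero.2 (by exact_mod_cast h)
  have h3 : (ξ : ℂ) - rho r z ≠ 0 := by
    intro h0; rw [h0, mul_zero] at h1; exact h2 h1.symm
  rw [eq_div_iff h2, ← h1]; field_simp

/-- The logarithmic derivative of ξᵏ - rᵏ. Expanding each fraction as a geometric sum, orthogonality
of the roots of unity kills all powers but m = k - 1. Replacing z by its conjugate for r < 0 only
permutes the roots. -/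
lemma sum_inv_sub_rho {k : ℕ} (hk : 1 ≤ k) {r ξ : ℝ} (h : ξ ^ k ≠ r ^ k) :
    ∑ n ∈ Finset.range k, ((ξ : ℂ) - rho r (unityRoot k n))⁻¹
      = k * (ξ : ℂ) ^ (k - 1) / ((ξ : ℂ) ^ k - (r : ℂ) ^ k) := by
  rw [Finset.sum_congr rfl fun n _ => inv_sub_rho_eq (unityRoot_pow (by omega) n) h,
    ← Finset.sum_div, Finset.sum_comm]
  congr 1
  have : ∀ m ∈ Finset.range k,
      ∑ n ∈ Finset.range k, (ξ : ℂ) ^ m * rho r (unityRoot k n) ^ (k - 1 - m)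
        = if m = k - 1 then (k : ℂ) * (ξ : ℂ) ^ (k - 1) else 0 := by
    intro m hm
    have hm' := Finset.mem_range.1 hm
    rw [← Finset.mul_sum, sum_rho_pow (by omega)]
    by_cases h0 : m = k - 1
    · rw [if_pos (by omega), if_pos h0, h0, mul_comm]
    · rw [if_neg (by omega), if_neg h0, mul_zero]
  rw [Finset.sum_congr rfl this, Finset.sum_ite_eq' ]
  rw [if_pos (Finset.mem_range.2 (by omega))]

/-! ### Moving the roots off the real axis -/

/-- The point `z` moved vertically by `ε`, away from the real axis. -/
noncomputable def awayFromReal (z : ℂ) (ε : ℝ) : ℂ :=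
  z + ((if 0 ≤ z.im then ε else -ε : ℝ) : ℂ) * I

@[simp] lemma awayFromReal_re (z : ℂ) (ε : ℝ) : (awayFromReal z ε).re = z.re := by
  simp [awayFromReal]

@[simp] lemma awayFromReal_im (z : ℂ) (ε : ℝ) :
    (awayFromReal z ε).im = z.im + if 0 ≤ z.im then ε else -ε := by
  simp [awayFromReal]

lemma abs_awayFromReal_im (z : ℂ) {ε : ℝ} (hε : 0 ≤ ε) :
    |(awayFromReal z ε).im| = |z.im| + ε := by
  rw [awayFromReal_im]
  split_ifs with h
  · rw [abs_of_nonneg h, abs_of_nonneg (by linarith)]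
  · push Not at h
    rw [abs_of_neg h, abs_of_neg (by linarith)]; ring

lemma awayFromReal_im_ne_zero (z : ℂ) {ε : ℝ} (hε : 0 < ε) : (awayFromReal z ε).im ≠ 0 := by
  rw [← abs_pos, abs_awayFromReal_im z hε.le]; positivity

lemma norm_awayFromReal_le (z : ℂ) {ε : ℝ} (hε : 0 ≤ ε) : ‖awayFromReal z ε‖ ≤ ‖z‖ + ε := by
  refine (norm_add_le _ _).trans ?_
  rw [norm_mul, norm_I, mul_one, norm_real, Real.norm_eq_abs]
  split_ifs <;> simp [abs_of_nonneg hε]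

lemma norm_sub_rho_le (z : ℂ) {ε : ℝ} (hε : 0 ≤ ε) (r ξ : ℝ) :
    ‖(ξ : ℂ) - rho r z‖ ≤ ‖(ξ : ℂ) - rho r (awayFromReal z ε)‖ := by
  rw [← abs_norm, ← abs_norm ((ξ : ℂ) - rho r (awayFromReal z ε)), ← sq_le_sq, ← normSq_eq_norm_sq,
    ← normSq_eq_norm_sq, normSq_apply, normSq_apply]
  simp only [sub_re, ofReal_re, rho_re, sub_im, ofReal_im, rho_im, zero_sub, neg_mul_neg,
    awayFromReal_re]
  gcongr ?_ + ?_
  · exact le_rfl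
  rw [← pow_two, ← pow_two, mul_pow, mul_pow]
  gcongr 1
  rw [sq_le_sq, abs_awayFromReal_im z hε]
  linarith

lemma tendsto_awayFromReal (z : ℂ) :
    Tendsto (fun n : ℕ => awayFromReal z (1 / ((n : ℝ) + 1))) atTop (𝓝 z) := by
  have h : Continuous fun ε : ℝ => awayFromReal z ε := by
    unfold awayFromReal; split_ifs <;> fun_prop
  have h0 : awayFromReal z 0 = z := by simp [awayFromReal]
  have h2 := (h.tendsto 0).comp (tendsto_one_div_add_atTop_nhds_zero_nat (𝕜 := ℝ))
  rwa [h0] at h2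

lemma continuous_rho (r : ℝ) : Continuous (rho r) := by
  unfold rho; fun_prop

/-- ξᵏ - rᵏ is divisible by ξ - `rho r z`, and moving the root away from the real axis only
increases its distance to ξ. Hence the symbol controls the perturbed pole uniformly in ε. -/
lemma norm_pow_sub_pow_le {k : ℕ} (hk : 1 ≤ k) {z : ℂ} (hz : z ^ k = 1) (hz1 : ‖z‖ = 1) {r ξ T : ℝ}
    (hT : |ξ| ≤ T) (hrT : |r| ≤ T) {ε : ℝ} (hε : 0 ≤ ε) :
    ‖(ξ : ℂ) ^ k - (r : ℂ) ^ k‖ ≤ k * T ^ (k - 1) * ‖(ξ : ℂ) - rho r (awayFromReal z ε)‖ := by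
  have hT0 : 0 ≤ T := (abs_nonneg _).trans hT
  rw [← rho_pow hz r, ← geom_sum₂_mul, norm_mul]
  refine mul_le_mul ?_ (norm_sub_rho_le z hε r ξ) (norm_nonneg _) (by positivity)
  refine (norm_sum_le _ _).trans ?_
  have : ∀ m ∈ Finset.range k, ‖(ξ : ℂ) ^ m * rho r z ^ (k - 1 - m)‖ ≤ T ^ (k - 1) := by
    intro m hm
    have hm' := Finset.mem_range.1 hm
    rw [norm_mul, norm_pow, norm_pow, norm_rho, hz1, mul_one, norm_real, Real.norm_eq_abs]
    calc _ ≤ T ^ m * T ^ (k - 1 - m) := by gcongr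
      _ = T ^ (k - 1) := by rw [← pow_add]; congr 1; omega
  refine (Finset.sum_le_sum this).trans_eq ?_
  simp

/-! ### Passing to the limit -/

lemma ae_notMem_of_finite_slices {i j : Fin 2} (hij : i ≠ j) {S : Set (ℝ × ℝ)}
    (hS : MeasurableSet S) (hfin : ∀ x, (Prod.mk x ⁻¹' S).Finite) :
    ∀ᵐ q : Plane, (q i, q j) ∉ S := by
  have h0 : (volume.prod volume : Measure (ℝ × ℝ)) S = 0 :=
    (Measure.measure_prod_null hS).2 (Eventually.of_forall fun x => (hfin x).measure_zero _)
  exact (measurePreserving_coords hij).quasiMeasurePreserving.ae (p := fun q => q ∉ S)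
    (by rw [ae_iff]; simpa using h0)

lemma ae_coord_ne_zero {i j : Fin 2} (hij : i ≠ j) : ∀ᵐ q : Plane, q j ≠ 0 := by
  refine ae_notMem_of_finite_slices hij (S := {q | q.2 = 0})
    (measurableSet_eq_fun (by fun_prop) (by fun_prop)) fun x => ?_
  exact (finite_singleton (0 : ℝ)).subset fun η hη => hη

lemma ae_pow_ne_mul_pow (k : ℕ) {l : ℕ} (hl : 1 ≤ l) {i j : Fin 2} (hij : i ≠ j) {a : ℝ}
    (ha : a ≠ 0) : ∀ᵐ q : Plane, q i ^ k ≠ a * q j ^ l := by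
  refine ae_notMem_of_finite_slices hij (S := {q | q.1 ^ k = a * q.2 ^ l})
    (measurableSet_eq_fun (by fun_prop) (by fun_prop)) fun x => ?_
  refine (Polynomial.nthRoots l (x ^ k / a)).toFinset.finite_toSet.subset fun η hη => ?_
  simp only [Finset.mem_coe, Multiset.mem_toFinset]
  rw [Polynomial.mem_nthRoots (by omega), eq_div_iff ha, mul_comm]
  exact (show x ^ k = a * η ^ l from hη).symm

lemma branch_ne_zero {r s p η : ℝ} (hr : r ≠ 0) (hs : s ≠ 0) (hη : η ≠ 0) :
    branch r s p η ≠ 0 := by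
  rw [branch]
  refine mul_ne_zero (by split_ifs <;> assumption) ?_
  exact (Real.rpow_pos_of_pos (abs_pos.2 hη) p).ne'

lemma weight_mul_pow (l : ℕ) {δ R : ℝ} (hδ : 0 < δ) (η : ℝ) :
    weight l δ R η * (η : ℂ) ^ l
      = (((annulus δ R).indicator (fun η => |η| ^ (l - 1)) η : ℝ) : ℂ) := by
  by_cases h : η ∈ annulus δ R
  · have hη : η ≠ 0 := abs_pos.1 (hδ.trans_le h.1)
    have hη' : (η : ℂ) ≠ 0 := by exact_mod_cast hη
    rw [weight, indicator_of_mem h, indicator_of_mem h]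
    push_cast
    field_simp
  · rw [weight, indicator_of_notMem h, indicator_of_notMem h, zero_mul, ofReal_zero]

section Limit

variable {k l : ℕ} {p r s r' s' a b : ℝ}

/-- The ε-independent majorant for dominated convergence: each of the two symbols cancels one of the
two poles. -/
lemma norm_kernel_mul_le (hk : 1 ≤ k) (hl : 1 ≤ l) (hp : 0 < p)
    (hr : r ≠ 0) (hs : s ≠ 0) (hr' : r' ≠ 0) (hs' : s' ≠ 0) {δ R : ℝ} (hδ : 0 < δ) (hR : 0 ≤ R)
    {z : ℂ} (hz : z ^ k = 1) (hz1 : ‖z‖ = 1) {ε : ℝ} (hε : 0 < ε) (hε1 : ε ≤ 1) (ξ η : ℝ) :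
    ‖kernel l p δ R r s r' s' (awayFromReal z ε) ξ η *
        (((ξ : ℂ) ^ k - (branch r s p η : ℂ) ^ k) * ((ξ : ℂ) ^ k - (branch r' s' p η : ℂ) ^ k))‖
      ≤ δ⁻¹ * (4 * ((|r| + |s| + (|r'| + |s'|)) * R ^ p)) *
        (k * (|ξ| + (|r| + |s| + (|r'| + |s'|)) * R ^ p) ^ (k - 1)) ^ 2 := by
  set N := (|r| + |s| + (|r'| + |s'|)) * R ^ p
  have hN : 0 ≤ N := by positivity
  by_cases h : η ∈ annulus δ R
  swap
  · rw [kernel, weight, indicator_of_notMem h, zero_mul, zero_mul, norm_zero]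
    positivity
  have hη : η ≠ 0 := abs_pos.1 (hδ.trans_le h.1)
  set A := branch r s p η
  set B := branch r' s' p η
  have hA0 : A ≠ 0 := branch_ne_zero hr hs hη
  have hB0 : B ≠ 0 := branch_ne_zero hr' hs' hη
  have hA : |A| ≤ N := (abs_branch_le hp h).trans (by
    exact mul_le_mul_of_nonneg_right (le_add_of_nonneg_right (by positivity)) (by positivity))
  have hB : |B| ≤ N := (abs_branch_le hp h).trans (by
    exact mul_le_mul_of_nonneg_right (le_add_of_nonneg_left (by positivity)) (by positivity))
  set w := awayFromReal z ε
  have hw : w.im ≠ 0 := awayFromReal_im_ne_zero z hε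
  have hw2 : ‖w‖ ≤ 2 := (norm_awayFromReal_le z hε.le).trans (by rw [hz1]; linarith)
  have n1 : (ξ : ℂ) - rho A w ≠ 0 := ofReal_sub_ne_zero (by
    rw [rho_im]; exact mul_ne_zero (abs_ne_zero.2 hA0) hw) ξ
  have n2 : (ξ : ℂ) - rho B w ≠ 0 := ofReal_sub_ne_zero (by
    rw [rho_im]; exact mul_ne_zero (abs_ne_zero.2 hB0) hw) ξ
  have p1 := norm_pos_iff.2 n1
  have p2 := norm_pos_iff.2 n2
  have hT : |ξ| ≤ |ξ| + N := le_add_of_nonneg_right hN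
  have b1 := norm_pow_sub_pow_le hk hz hz1 hT
    (hA.trans (le_add_of_nonneg_left (abs_nonneg ξ))) hε.le
  have b2 := norm_pow_sub_pow_le hk hz hz1 hT
    (hB.trans (le_add_of_nonneg_left (abs_nonneg ξ))) hε.le
  have hwt := norm_weight_le hl (R := R) hδ η
  rw [indicator_of_mem h] at hwt
  set T := (k : ℝ) * (|ξ| + N) ^ (k - 1)
  have hT0 : 0 ≤ T := by positivity
  have hdiff : ‖rho A w - rho B w‖ ≤ 4 * N := by
    refine (norm_sub_le _ _).trans ?_
    rw [norm_rho, norm_rho]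
    have e1 : |A| * ‖w‖ ≤ N * 2 := by gcongr
    have e2 : |B| * ‖w‖ ≤ N * 2 := by gcongr
    linarith
  have e : fracDiff (rho A w) (rho B w) ξ
      = (rho A w - rho B w) * (((ξ : ℂ) - rho A w)⁻¹ * ((ξ : ℂ) - rho B w)⁻¹) := by
    rw [fracDiff]; field_simp; ring
  rw [kernel, e]
  simp only [norm_mul, norm_inv]
  calc _ ≤ δ⁻¹ * ((4 * N) * (‖(ξ : ℂ) - rho A w‖⁻¹ * ‖(ξ : ℂ) - rho B w‖⁻¹)) *
        ((T * ‖(ξ : ℂ) - rho A w‖) * (T * ‖(ξ : ℂ) - rho B w‖)) := by gcongr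
    _ = _ := by field_simp

lemma tendsto_sum_kernel (hk : 1 ≤ k) (δ R : ℝ) {ξ η : ℝ}
    (hA : ξ ^ k ≠ branch r s p η ^ k) (hB : ξ ^ k ≠ branch r' s' p η ^ k) :
    Tendsto (fun n : ℕ => ∑ m ∈ Finset.range k,
        kernel l p δ R r s r' s' (awayFromReal (unityRoot k m) (1 / ((n : ℝ) + 1))) ξ η)
      atTop (𝓝 (weight l δ R η *
        (k * (ξ : ℂ) ^ (k - 1) / ((ξ : ℂ) ^ k - (branch r s p η : ℂ) ^ k)
          - k * (ξ : ℂ) ^ (k - 1) / ((ξ : ℂ) ^ k - (branch r' s' p η : ℂ) ^ k)))) := by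
  rw [← sum_inv_sub_rho hk hA, ← sum_inv_sub_rho hk hB, ← Finset.sum_sub_distrib, Finset.mul_sum]
  refine tendsto_finsetSum _ fun m _ => ?_
  have key : ∀ A : ℝ, ξ ^ k ≠ A ^ k → Tendsto (fun n : ℕ =>
      ((ξ : ℂ) - rho A (awayFromReal (unityRoot k m) (1 / ((n : ℝ) + 1))))⁻¹) atTop
      (𝓝 (((ξ : ℂ) - rho A (unityRoot k m))⁻¹)) := by
    intro A hA
    refine (tendsto_const_nhds.sub
      (((continuous_rho A).tendsto _).comp (tendsto_awayFromReal _))).inv₀ fun h0 => hA ?_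
    have h1 := rho_pow (unityRoot_pow (by omega : k ≠ 0) m) A
    rw [← sub_eq_zero.1 h0] at h1
    exact_mod_cast h1
  exact ((key _ hA).sub (key _ hB)).const_mul _

/-- The bilinear estimate with the weight truncated to `δ ≤ |η| ≤ R`. -/
theorem exists_norm_integral_truncated_le (hk : Odd k) (hl : 1 ≤ l) (hp : 0 < p) (hp1 : p ≠ 1)
    (hr : r ≠ 0) (hs : s ≠ 0) (hr' : r' ≠ 0) (hs' : s' ≠ 0) (ha : a ≠ 0) (hb : b ≠ 0)
    (hab : a ≠ b) (hA : ∀ η, branch r s p η ^ k = a * η ^ l)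
    (hB : ∀ η, branch r' s' p η ^ k = b * η ^ l) {i j : Fin 2} (hij : i ≠ j) :
    ∃ C : ℝ, 0 ≤ C ∧ ∀ F G W : Plane → ℂ, Integrable F → Integrable G →
      AEStronglyMeasurable W → (∀ n : ℕ, Integrable fun q => (1 + ‖q‖) ^ n * ‖W q‖) →
      (∀ q, 𝓕 F q * conj (𝓕 G q) = (((q i : ℂ) ^ k - a * (q j : ℂ) ^ l) *
        ((q i : ℂ) ^ k - b * (q j : ℂ) ^ l)) * W q) →
      ∀ δ R : ℝ, 0 < δ → δ ≤ R →
      ‖∫ q : Plane, (((annulus δ R).indicator (fun η => |η| ^ (l - 1)) (q j) * |q i| ^ (k - 1) : ℝ)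
        : ℂ) * W q‖ ≤ C * (∫ x, ‖F x‖) * ∫ x, ‖G x‖ := by
  have hk1 : 1 ≤ k := hk.pos
  obtain ⟨C, hC0, hC⟩ := exists_norm_fourier_kernel_le hp hp1 hr hs hr' hs'
  -- The sum has k kernels, each bounded by `C`; its limit is k(a - b) times the desired multiplier.
  refine ⟨(k * |a - b|)⁻¹ * (k * C), by positivity,
    fun F G W hF hG hWm hW hFG δ R hδ hδR => ?_⟩
  have hAc : ∀ η : ℝ, (branch r s p η : ℂ) ^ k = a * (η : ℂ) ^ l := fun η => by
    exact_mod_cast hA η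
  have hBc : ∀ η : ℝ, (branch r' s' p η : ℂ) ^ k = b * (η : ℂ) ^ l := fun η => by
    exact_mod_cast hB η
  have hR : 0 ≤ R := hδ.le.trans hδR
  set ε : ℕ → ℝ := fun n => 1 / ((n : ℝ) + 1)
  have hε : ∀ n, 0 < ε n := fun n => by simp only [ε]; positivity
  have hε1 : ∀ n, ε n ≤ 1 := fun n => by
    simp only [ε]; rw [div_le_one (by positivity)]; linarith [Nat.cast_nonneg (α := ℝ) n]
  set M : ℕ → ℕ → Plane → ℂ := fun n m q =>
    kernel l p δ R r s r' s' (awayFromReal (unityRoot k m) (ε n)) (q i) (q j) with hM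
  have hMi : ∀ n m, Integrable (M n m) := fun n m =>
    integrable_comp_coords hij (integrable_kernel hl hp hδ hr hs hr' hs'
      (awayFromReal_im_ne_zero _ (hε n)))
  set Φ : ℕ → Plane → ℂ := fun n q =>
    (∑ m ∈ Finset.range k, M n m q) * (𝓕 F q * conj (𝓕 G q)) with hΦ
  have hΦ_le : ∀ n, ‖∫ q, Φ n q‖ ≤ (k * C) * (∫ x, ‖F x‖) * ∫ x, ‖G x‖ := by
    intro n
    have hint : ∀ m ∈ Finset.range k, Integrable fun q => M n m q * (𝓕 F q * conj (𝓕 G q)) := by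
      intro m _
      refine (hMi n m).mul_bdd (c := (∫ x, ‖F x‖) * ∫ x, ‖G x‖)
        ((continuous_fourier hF).mul
          (continuous_conj.comp (continuous_fourier hG))).aestronglyMeasurable
        (Eventually.of_forall fun q => ?_)
      rw [norm_mul, RCLike.norm_conj]
      gcongr
      exacts [norm_fourier_le_integral_norm F q, norm_fourier_le_integral_norm G q]
    simp only [hΦ, Finset.sum_mul]
    rw [integral_finsetSum _ hint]
    refine (norm_sum_le _ _).trans ((Finset.sum_le_sum fun m _ =>
      norm_integral_mul_fourier_le (hMi n m) hF hG
        (hC hl hδ hδR (awayFromReal_im_ne_zero _ (hε n)) hij)).trans_eq ?_)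
    rw [Finset.sum_const, Finset.card_range, nsmul_eq_mul]; ring
  set Ψ : Plane → ℂ := fun q => (((annulus δ R).indicator (fun η => |η| ^ (l - 1)) (q j) *
    |q i| ^ (k - 1) : ℝ) : ℂ) * W q with hΨ
  set N := (|r| + |s| + (|r'| + |s'|)) * R ^ p with hN
  have hN0 : 0 ≤ N := by positivity
  set K := k * (δ⁻¹ * (4 * N) * (k * (1 + N) ^ (k - 1)) ^ 2) with hK
  have hlim : Tendsto (fun n => ∫ q, Φ n q) atTop
      (𝓝 (∫ q, (k * ((a : ℂ) - b)) * Ψ q)) := by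
    refine tendsto_integral_of_dominated_convergence
      (fun q => K * ((1 + ‖q‖) ^ (2 * (k - 1)) * ‖W q‖)) (fun n => ?_)
      ((hW _).const_mul K) (fun n => Eventually.of_forall fun q => ?_) ?_
    · exact (integrable_finsetSum _ fun m _ => hMi n m).aestronglyMeasurable.mul
        ((continuous_fourier hF).mul
          (continuous_conj.comp (continuous_fourier hG))).aestronglyMeasurable
    · simp only [hΦ]
      rw [hFG, Finset.sum_mul]
      refine (norm_sum_le _ _).trans ?_
      have : ∀ m ∈ Finset.range k, ‖M n m q * ((((q i : ℂ) ^ k - a * (q j : ℂ) ^ l) *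
          ((q i : ℂ) ^ k - b * (q j : ℂ) ^ l)) * W q)‖
          ≤ (δ⁻¹ * (4 * N) * (k * (1 + N) ^ (k - 1)) ^ 2) *
            ((1 + ‖q‖) ^ (2 * (k - 1)) * ‖W q‖) := by
        intro m _
        have h1 := norm_kernel_mul_le hk1 hl hp hr hs hr' hs' hδ hR
          (unityRoot_pow (by omega : k ≠ 0) m) (norm_unityRoot (by omega : k ≠ 0) m)
          (hε n) (hε1 n) (q i) (q j)
        rw [hAc, hBc, ← hN] at h1
        rw [← mul_assoc, norm_mul]
        have hq : |q i| ≤ ‖q‖ := by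
          rw [← Real.norm_eq_abs]; exact PiLp.norm_apply_le q i
        have h2 : |q i| + N ≤ (1 + N) * (1 + ‖q‖) := by nlinarith [norm_nonneg q]
        calc _ ≤ (δ⁻¹ * (4 * N) * (k * (|q i| + N) ^ (k - 1)) ^ 2) * ‖W q‖ := by
              gcongr
          _ ≤ (δ⁻¹ * (4 * N) * (k * ((1 + N) * (1 + ‖q‖)) ^ (k - 1)) ^ 2) * ‖W q‖ := by
              gcongr
          _ = _ := by rw [mul_pow (1 + N), pow_mul' _ 2]; ring
      refine (Finset.sum_le_sum this).trans_eq ?_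
      rw [Finset.sum_const, Finset.card_range, nsmul_eq_mul, hK]; ring
    -- Off the null curves ξᵏ = aηˡ and ξᵏ = bηˡ the sum over roots converges, and partial fractions
    -- produce the factor (a - b)ηˡ. Oddness of k gives |ξ|^(k-1) = ξ^(k-1) in `hev`.
    · filter_upwards [ae_pow_ne_mul_pow k hl hij ha, ae_pow_ne_mul_pow k hl hij hb] with q h1 h2
      have h3 := (tendsto_sum_kernel (l := l) (p := p) (r := r) (s := s) (r' := r') (s' := s') hk1 δ R
        (ξ := q i) (η := q j) (by rwa [hA]) (by rwa [hB])).mul_const (𝓕 F q * conj (𝓕 G q))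
      convert h3 using 2
      have d1 : (q i : ℂ) ^ k - a * (q j : ℂ) ^ l ≠ 0 := sub_ne_zero.2 (by exact_mod_cast h1)
      have d2 : (q i : ℂ) ^ k - b * (q j : ℂ) ^ l ≠ 0 := sub_ne_zero.2 (by exact_mod_cast h2)
      have hev : |q i| ^ (k - 1) = q i ^ (k - 1) := (hk.tsub_odd odd_one).pow_abs _
      simp only [hΨ]
      rw [hAc, hBc, hFG, ofReal_mul, ← weight_mul_pow l hδ, hev]
      push_cast
      field_simp
      ring
  have hfin := le_of_tendsto hlim.norm (Eventually.of_forall hΦ_le)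
  rw [integral_const_mul, norm_mul] at hfin
  have hkab : ‖(k * ((a : ℂ) - b))‖ = k * |a - b| := by
    rw [norm_mul, ← ofReal_sub, norm_real, norm_natCast, Real.norm_eq_abs]
  rw [hkab] at hfin
  have hpos : 0 < k * |a - b| := mul_pos (by exact_mod_cast hk1) (abs_pos.2 (sub_ne_zero.2 hab))
  calc _ ≤ (k * |a - b|)⁻¹ * ((k * C) * (∫ x, ‖F x‖) * ∫ x, ‖G x‖) := by
        rw [le_inv_mul_iff₀ hpos]; exact hfin
    _ = _ := by ring

end Limit

/-! ### Real branches of ξᵏ = aηˡ, and removal of the truncation. -/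

lemma exists_pow_eq_of_odd {k : ℕ} (hk : Odd k) {c : ℝ} (hc : c ≠ 0) :
    ∃ r : ℝ, r ≠ 0 ∧ r ^ k = c := by
  have hk0 : k ≠ 0 := hk.pos.ne'
  have key : ∀ c : ℝ, 0 ≤ c → ∃ r : ℝ, r ^ k = c := fun c hc0 =>
    ⟨c ^ (k : ℝ)⁻¹, Real.rpow_inv_natCast_pow hc0 hk0⟩
  obtain ⟨r, hr⟩ : ∃ r : ℝ, r ^ k = c := by
    rcases le_total 0 c with h | h
    · exact key c h
    · obtain ⟨r, hr⟩ := key (-c) (by linarith)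
      exact ⟨-r, by rw [hk.neg_pow, hr, neg_neg]⟩
  exact ⟨r, fun h => hc (by rw [← hr, h, zero_pow hk0]), hr⟩

lemma exists_branch_pow_eq {k l : ℕ} (hk : Odd k) {a : ℝ} (ha : a ≠ 0) :
    ∃ r s : ℝ, r ≠ 0 ∧ s ≠ 0 ∧ ∀ η, branch r s ((l : ℝ) / k) η ^ k = a * η ^ l := by
  obtain ⟨r, hr, hrk⟩ := exists_pow_eq_of_odd hk ha
  obtain ⟨s, hs, hsk⟩ := exists_pow_eq_of_odd hk
    (mul_ne_zero ha (pow_ne_zero l (by norm_num : (-1 : ℝ) ≠ 0)))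
  refine ⟨r, s, hr, hs, fun η => ?_⟩
  have hk0 : (k : ℝ) ≠ 0 := by exact_mod_cast hk.pos.ne'
  have h1 : (|η| ^ ((l : ℝ) / k)) ^ k = |η| ^ l := by
    rw [← Real.rpow_natCast, ← Real.rpow_mul (abs_nonneg _), div_mul_cancel₀ _ hk0,
      Real.rpow_natCast]
  rw [branch, mul_pow, h1]
  split_ifs with h
  · rw [hrk, abs_of_nonneg h]
  · push Not at h
    rw [hsk, abs_of_neg h, mul_assoc, ← mul_pow]
    ring_nf

/-- The weighted bilinear estimate for two functions whose product of Fourier transforms is divisible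
by both symbols. -/
theorem exists_norm_integral_weight_le {k l : ℕ} (hk : Odd k) (hl : 1 ≤ l) (hkl : k ≠ l) {a b : ℝ}
    (ha : a ≠ 0) (hb : b ≠ 0) (hab : a ≠ b) {i j : Fin 2} (hij : i ≠ j) :
    ∃ C : ℝ, 0 ≤ C ∧ ∀ F G W : Plane → ℂ, Integrable F → Integrable G →
      AEStronglyMeasurable W → (∀ n : ℕ, Integrable fun q => (1 + ‖q‖) ^ n * ‖W q‖) →
      (∀ q, 𝓕 F q * conj (𝓕 G q) = (((q i : ℂ) ^ k - a * (q j : ℂ) ^ l) *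
        ((q i : ℂ) ^ k - b * (q j : ℂ) ^ l)) * W q) →
      ‖∫ q : Plane, ((|q j| ^ (l - 1) * |q i| ^ (k - 1) : ℝ) : ℂ) * W q‖
        ≤ C * (∫ x, ‖F x‖) * ∫ x, ‖G x‖ := by
  have hk0 : (0 : ℝ) < k := by exact_mod_cast hk.pos
  have hl0 : (0 : ℝ) < l := by exact_mod_cast hl
  obtain ⟨r, s, hr, hs, hA⟩ := exists_branch_pow_eq (l := l) hk ha
  obtain ⟨r', s', hr', hs', hB⟩ := exists_branch_pow_eq (l := l) hk hb
  have hp1 : (l : ℝ) / k ≠ 1 := by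
    rw [Ne, div_eq_one_iff_eq hk0.ne']; exact_mod_cast hkl.symm
  obtain ⟨C, hC0, hC⟩ := exists_norm_integral_truncated_le hk hl (div_pos hl0 hk0) hp1 hr hs hr' hs'
    ha hb hab hA hB hij
  refine ⟨C, hC0, fun F G W hF hG hWm hW hFG => ?_⟩
  have hδ : ∀ n : ℕ, (0 : ℝ) < 1 / ((n : ℝ) + 1) := fun n => by positivity
  have hδR : ∀ n : ℕ, 1 / ((n : ℝ) + 1) ≤ (n : ℝ) + 1 := fun n => by
    have : (0 : ℝ) ≤ n := n.cast_nonneg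
    rw [div_le_iff₀ (by positivity)]; nlinarith
  have hbound := fun n : ℕ => hC F G W hF hG hWm hW hFG _ _ (hδ n) (hδR n)
  refine le_of_tendsto (x := atTop) (Tendsto.norm ?_) (Eventually.of_forall hbound)
  have hcoord : ∀ (q : Plane) (i : Fin 2), |q i| ≤ 1 + ‖q‖ := fun q i => by
    rw [← Real.norm_eq_abs]; linarith [PiLp.norm_apply_le q i]
  refine tendsto_integral_of_dominated_convergence
    (fun q => (1 + ‖q‖) ^ (l - 1 + (k - 1)) * ‖W q‖) (fun n => ?_) (hW _)
    (fun n => Eventually.of_forall fun q => ?_) ?_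
  · have h1 : Measurable fun q : Plane =>
        (annulus (1 / ((n : ℝ) + 1)) (n + 1)).indicator (fun η => |η| ^ (l - 1)) (q j) :=
      (Measurable.indicator (by fun_prop) (measurableSet_annulus _ _)).comp
        (by fun_prop : Measurable fun q : Plane => q j)
    have h2 : Measurable fun q : Plane => |q i| ^ (k - 1) := by fun_prop
    exact (measurable_ofReal.comp (h1.mul h2)).aestronglyMeasurable.mul hWm
  · rw [norm_mul, norm_real, norm_mul, pow_add]
    refine mul_le_mul_of_nonneg_right (mul_le_mul ?_ ?_ (norm_nonneg _) (by positivity))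
      (norm_nonneg _)
    · refine (norm_indicator_le_norm_self _ _).trans ?_
      rw [norm_pow, Real.norm_eq_abs, abs_abs]
      gcongr
      exact hcoord q j
    · rw [norm_pow, Real.norm_eq_abs, abs_abs]
      gcongr
      exact hcoord q i
  · filter_upwards [ae_coord_ne_zero hij] with q hq
    refine tendsto_const_nhds.congr' ?_
    have hq0 : 0 < |q j| := abs_pos.2 hq
    -- For η ≠ 0 the truncation is eventually inactive, so the integrand is eventually constant in
    -- n.
    filter_upwards [eventually_ge_atTop (max ⌈|q j|⌉₊ ⌈|q j|⁻¹⌉₊)] with n hn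
    have h1 : |q j| ≤ n := (Nat.le_ceil _).trans (by exact_mod_cast (le_max_left _ _).trans hn)
    have h2 : |q j|⁻¹ ≤ n := (Nat.le_ceil _).trans (by exact_mod_cast (le_max_right _ _).trans hn)
    have hmem : q j ∈ annulus (1 / ((n : ℝ) + 1)) (n + 1) := by
      refine ⟨?_, by linarith⟩
      rw [one_div, inv_le_comm₀ (by positivity) hq0]; linarith
    rw [indicator_of_mem hmem]

/-! ### The differential operators on the Fourier side -/

lemma fourier_partialD (j : Fin 2) (f : 𝓢(Plane, ℂ)) (q : Plane) :
    𝓕 (partialD j f) q = 2 * Real.pi * I * (q j : ℂ) * 𝓕 f q := by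
  have htg : (fun x : Plane => inner ℝ x (EuclideanSpace.single j (1 : ℝ))).HasTemperateGrowth :=
    ((innerSL ℝ).flip (EuclideanSpace.single j (1 : ℝ) : Plane)).hasTemperateGrowth
  rw [partialD, SchwartzMap.fourier_lineDerivOp_eq, smul_apply,
    SchwartzMap.smulLeftCLM_apply_apply htg, EuclideanSpace.inner_single_right]
  simp only [conj_trivial, one_mul, smul_eq_mul, real_smul]
  ring

lemma fourier_iterate_partialD (j : Fin 2) (n : ℕ) (f : 𝓢(Plane, ℂ)) (q : Plane) :
    𝓕 ((partialD j)^[n] f) q = (2 * Real.pi * I * (q j : ℂ)) ^ n * 𝓕 f q := by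
  induction n with
  | zero => simp
  | succ n ih => rw [Function.iterate_succ_apply', fourier_partialD, ih]; ring

lemma fourier_diffOp (k l : ℕ) (τ : ℂ) (f : 𝓢(Plane, ℂ)) (q : Plane) :
    𝓕 (diffOp k l τ f) q = ((2 * Real.pi * I * (q 0 : ℂ)) ^ k
      - τ * (2 * Real.pi * I * (q 1 : ℂ)) ^ l) * 𝓕 f q := by
  rw [diffOp, sub_eq_add_neg, ← neg_smul, FourierTransform.fourier_add,
    FourierTransform.fourier_smul, add_apply, smul_apply,
    fourier_iterate_partialD, fourier_iterate_partialD, smul_eq_mul]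
  ring

lemma two_pi_I_pow_mul_tauOne (k l : ℕ) (τ : ℂ) :
    (2 * (Real.pi : ℂ) * I) ^ k * tauOne k l τ = (2 * (Real.pi : ℂ) * I) ^ l * τ := by
  rw [tauOne, ← mul_assoc, ← zpow_natCast, ← zpow_add₀ Complex.two_pi_I_ne_zero,
    add_sub_cancel, zpow_natCast]

/-- The hypothesis on σ₁ thus says that σ satisfies the same reality condition as τ, so one symbol
computation serves both operators. -/
lemma tauOne_eq_conj_sigmaOne (k l : ℕ) (σ : ℂ) : tauOne k l σ = conj (sigmaOne k l σ) := by
  rw [tauOne, sigmaOne, map_mul, conj_conj, ← mul_zpow, map_zpow₀]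
  congr 2
  simp [map_ofNat]

lemma symbol_eq {k l : ℕ} {τ : ℂ} {a : ℝ} (ha : tauOne k l τ = a) (x y : ℝ) :
    (2 * Real.pi * I * (x : ℂ)) ^ k - τ * (2 * Real.pi * I * (y : ℂ)) ^ l
      = (2 * (Real.pi : ℂ) * I) ^ k * ((x : ℂ) ^ k - a * (y : ℂ) ^ l) := by
  have := two_pi_I_pow_mul_tauOne k l τ
  rw [ha] at this
  rw [mul_pow, mul_pow _ _ l, mul_sub, ← mul_assoc _ (a : ℂ), this]
  ring

/-! ### Decay of the Schwartz data, exchange of coordinates, conclusion. -/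

lemma integrable_one_add_norm_pow_mul (f g : 𝓢(Plane, ℂ)) (c : ℂ) (n : ℕ) :
    Integrable fun q : Plane => (1 + ‖q‖) ^ n * ‖c * (f q * conj (g q))‖ := by
  have h1 : Integrable fun q : Plane => 2 ^ n * (‖q‖ ^ 0 * ‖f q‖ + ‖q‖ ^ n * ‖f q‖) :=
    ((f.integrable_pow_mul volume 0).add (f.integrable_pow_mul volume n)).const_mul _
  obtain ⟨D, hD⟩ := g.decay 0 0
  have hg : ∀ q, ‖g q‖ ≤ D := fun q => by simpa using hD.2 q
  refine (h1.mul_const (‖c‖ * D)).mono' (Continuous.aestronglyMeasurable ?_)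
    (Eventually.of_forall fun q => ?_)
  · have := f.continuous
    have := g.continuous
    fun_prop
  · have h2 : (1 + ‖q‖) ^ n ≤ 2 ^ n * (‖q‖ ^ 0 + ‖q‖ ^ n) := by
      have hq := norm_nonneg q
      rcases le_total ‖q‖ 1 with h | h
      · calc (1 + ‖q‖) ^ n ≤ 2 ^ n := by gcongr; linarith
          _ ≤ _ := le_mul_of_one_le_right (by positivity)
            (by rw [pow_zero]; exact le_add_of_nonneg_right (by positivity))
      · calc (1 + ‖q‖) ^ n ≤ (2 * ‖q‖) ^ n := by gcongr; linarith
          _ ≤ _ := by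
            rw [mul_pow]; gcongr; exact le_add_of_nonneg_left (by positivity)
    rw [Real.norm_of_nonneg (by positivity), norm_mul, norm_mul, RCLike.norm_conj]
    calc _ ≤ (2 ^ n * (‖q‖ ^ 0 + ‖q‖ ^ n)) * (‖c‖ * (‖f q‖ * D)) := by
          gcongr; exact hg q
      _ = _ := by ring

/-- The weighted bilinear estimate in the two coordinates in either order. -/
lemma exists_norm_integral_weight_le_of_odd_or_odd {k l : ℕ} (hk : 1 ≤ k) (hl : 1 ≤ l)
    (hodd : Odd k ∨ Odd l) (hkl : k ≠ l) {a b : ℝ} (ha : a ≠ 0) (hb : b ≠ 0) (hab : a ≠ b) :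
    ∃ C : ℝ, 0 ≤ C ∧ ∀ F G W : Plane → ℂ, Integrable F → Integrable G →
      AEStronglyMeasurable W → (∀ (c : ℂ) (n : ℕ), Integrable fun q => (1 + ‖q‖) ^ n * ‖c * W q‖) →
      (∀ q, 𝓕 F q * conj (𝓕 G q) = (((q 0 : ℂ) ^ k - a * (q 1 : ℂ) ^ l) *
        ((q 0 : ℂ) ^ k - b * (q 1 : ℂ) ^ l)) * W q) →
      ‖∫ q : Plane, ((|q 0| ^ (k - 1) * |q 1| ^ (l - 1) : ℝ) : ℂ) * W q‖
        ≤ C * (∫ x, ‖F x‖) * ∫ x, ‖G x‖ := by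
  rcases hodd with h | h
  · obtain ⟨C, hC0, hC⟩ := exists_norm_integral_weight_le h hl hkl ha hb hab
      (by decide : (0 : Fin 2) ≠ 1)
    refine ⟨C, hC0, fun F G W hF hG hWm hW hFG => ?_⟩
    have := hC F G W hF hG hWm (fun n => by simpa using hW 1 n) hFG
    simpa only [mul_comm (|_| ^ (l - 1))] using this
  · obtain ⟨C, hC0, hC⟩ := exists_norm_integral_weight_le h hk hkl.symm (inv_ne_zero ha)
      (inv_ne_zero hb) (inv_injective.ne hab) (by decide : (1 : Fin 2) ≠ 0)
    refine ⟨|a * b|⁻¹ * C, by positivity, fun F G W hF hG hWm hW hFG => ?_⟩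
    have hac : (a : ℂ) ≠ 0 := by exact_mod_cast ha
    have hbc : (b : ℂ) ≠ 0 := by exact_mod_cast hb
    -- With the coordinates exchanged, (ξᵏ - aηˡ)(ξᵏ - bηˡ) = ab(ηˡ - a⁻¹ξᵏ)(ηˡ - b⁻¹ξᵏ); the factor
    -- ab is moved into `W`.
    have := hC F G (fun q => (a * b : ℂ) * W q) hF hG (hWm.const_mul _) (hW _) (fun q => by
      rw [hFG]; push_cast; field_simp; ring)
    simp only [mul_left_comm _ (a * b : ℂ)] at this
    rw [integral_const_mul, norm_mul, ← ofReal_mul a b, norm_real, Real.norm_eq_abs] at this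
    rw [mul_assoc, mul_assoc, le_inv_mul_iff₀ (abs_pos.2 (mul_ne_zero ha hb)), ← mul_assoc]
    exact this

lemma rpow_two_mul_half_sub_one {k : ℕ} (hk : 1 ≤ k) (x : ℝ) :
    |x| ^ (2 * (((k : ℝ) - 1) / 2)) = |x| ^ (k - 1) := by
  rw [mul_div_cancel₀ _ (two_ne_zero), ← Nat.cast_one, ← Nat.cast_sub hk, Real.rpow_natCast]

/-- The bilinear embedding with weight `|ξ| ^ (k - 1) |η| ^ (l - 1)`. -/
theorem bilinearEmbedding_of_real (k l : ℕ) (hk : 1 ≤ k) (hl : 1 ≤ l) (hodd : Odd k ∨ Odd l) (hkl : k ≠ l)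
    (σ τ : ℂ) (hσ : σ ≠ 0) (hτ : τ ≠ 0) (hστ : σ ≠ τ)
    (hτ₁ : (tauOne k l τ).im = 0)
    (hσ₁ : (sigmaOne k l σ).im = 0) :
    BE k l (((k : ℝ) - 1) / 2) (((l : ℝ) - 1) / 2) σ τ := by
  have hpow : (2 * (Real.pi : ℂ) * I) ^ ((l : ℤ) - (k : ℤ)) ≠ 0 :=
    zpow_ne_zero _ Complex.two_pi_I_ne_zero
  obtain ⟨a, ha⟩ : ∃ a : ℝ, tauOne k l τ = a :=
    ⟨(tauOne k l τ).re, Complex.ext rfl (by simpa using hτ₁)⟩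
  obtain ⟨b, hb⟩ : ∃ b : ℝ, tauOne k l σ = b :=
    ⟨(tauOne k l σ).re, Complex.ext rfl (by
      rw [ofReal_im, tauOne_eq_conj_sigmaOne, conj_im, hσ₁, neg_zero])⟩
  have ha0 : a ≠ 0 := fun h => mul_ne_zero hpow hτ (by
    change tauOne k l τ = 0; rw [ha, h, ofReal_zero])
  have hb0 : b ≠ 0 := fun h => mul_ne_zero hpow hσ (by
    change tauOne k l σ = 0; rw [hb, h, ofReal_zero])
  have hab : a ≠ b := fun h => hστ (mul_left_cancel₀ hpow (by
    change tauOne k l σ = tauOne k l τ; rw [ha, hb, h]))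
  obtain ⟨C, hC0, hC⟩ := exists_norm_integral_weight_le_of_odd_or_odd hk hl hodd hkl ha0 hb0 hab
  -- The constant left after `symbol_eq` extracts (2πi)ᵏ from each symbol, the second one
  -- conjugated.
  set c : ℂ := (2 * (Real.pi : ℂ) * I) ^ k * conj ((2 * (Real.pi : ℂ) * I) ^ k) with hc
  have hc0 : c ≠ 0 := by
    have := pow_ne_zero k Complex.two_pi_I_ne_zero
    exact mul_ne_zero this ((map_ne_zero _).2 this)
  refine ⟨‖c‖⁻¹ * C, fun f g => ?_⟩
  have key := hC (diffOp k l τ f) (diffOp k l σ g) (fun q => c * (𝓕 f q * conj (𝓕 g q)))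
    (SchwartzMap.integrable _) (SchwartzMap.integrable _)
    (Continuous.aestronglyMeasurable (by
      have := (𝓕 f).continuous
      have := (𝓕 g).continuous
      fun_prop))
    (fun d n => by
      simp only [← mul_assoc d]
      exact integrable_one_add_norm_pow_mul (𝓕 f) (𝓕 g) (d * c) n)
    (fun q => by
      rw [← SchwartzMap.fourier_coe, ← SchwartzMap.fourier_coe, fourier_diffOp, fourier_diffOp,
        symbol_eq ha, symbol_eq hb, hc]
      simp only [map_mul, map_sub, map_pow, conj_ofReal]
      ring)
  simp only [mul_left_comm _ c] at key
  rw [integral_const_mul, norm_mul] at key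
  have hS : sobolevInner (((k : ℝ) - 1) / 2) (((l : ℝ) - 1) / 2) f g
      = ∫ q : Plane, ((|q 0| ^ (k - 1) * |q 1| ^ (l - 1) : ℝ) : ℂ) * (𝓕 f q * conj (𝓕 g q)) := by
    simp only [sobolevInner, rpow_two_mul_half_sub_one hk, rpow_two_mul_half_sub_one hl, mul_comm]
  rw [hS, mul_assoc, mul_assoc, le_inv_mul_iff₀ (norm_pos_iff.2 hc0), ← mul_assoc]
  exact key

end BilinearEmbedding

theorem theorem2 (k l : ℕ) (hk : 1 ≤ k) (hl : 1 ≤ l) (hodd : Odd k ∨ Odd l) (hkl : k ≠ l)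
    (σ τ : ℂ) (hσ : σ ≠ 0) (hτ : τ ≠ 0) (hστ : σ ≠ τ)
    (hτ₁ : (BilinearEmbedding.tauOne k l τ).im = 0)
    (hσ₁ : (BilinearEmbedding.sigmaOne k l σ).im = 0) :
    BilinearEmbedding.BE k l (((k : ℝ) - 1) / 2) (((l : ℝ) - 1) / 2) σ τ :=
  BilinearEmbedding.bilinearEmbedding_of_real k l hk hl hodd hkl σ τ hσ hτ hστ hτ₁ hσ₁
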